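/- Let $\mathbb{k}$ be a field of characteristic $0$ and let $\mathfrak g$ be a Lie algebra over $\mathbb{k}$ (of any dimension) that is nilpotent of class at most $2$, i.e. $[[X,Y],Z]=0$ for all $X,Y,Z\in\mathfrak g$. Let $H=U(\mathfrak g)$ with its usual Hopf algebra structure (comultiplication $\Delta$, counit $\epsilon$, antipode $S$; elements of $\mathfrak g$ are primitive). * The group $\mathrm{Aut}(F_2)$, $F_2=\langle x_1,x_2\rangle$, acts on $H^{\otimes 2}$ as follows: $\psi\cdot(h^1\otimes h^2)$ is obtained from $w_1\otimes w_2$, where $w_i=\psi^{-1}(x_i)$, by replacing the successive occurrences of $x_j$ or $x_j^{-1}$ in $w_1,w_2$ by $h^j_{(1)},h^j_{(2)},\dots$ (Sweedler notation), with $S$ applied when the exponent is $-1$ (and applying $\epsilon$ to $h^j$ if $x_j$ does not occur). * $H$ acts on $H^{\otimes 2}$ by conjugation, $h\circledast(a\otimes b)=h_{(1)}aS(h_{(2)})\otimes h_{(3)}bS(h_{(4)})$, and $\overline{H^{\otimes 2}}$ is the quotient of $H^{\otimes 2}$ by the span of all $(h-\epsilon(h)1)\circledast(a\otimes b)$. The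 action of $\mathrm{Aut}(F_2)$ descends to $\overline{H^{\otimes 2}}$ and inner automorphisms act trivially there, so $\overline{H^{\otimes 2}}$ is an $\mathrm{Out}(F_2)$-module. * $\mathrm{GL}_2(\mathbb Z)$ acts on $\mathrm{Sym}(\mathfrak g\otimes\mathbb{k}^2)$ through its standard action on $\mathbb{k}^2$. This descends to $\overline{\mathrm{Sym}(\mathfrak g\otimes\mathbb{k}^2)}$, the quotient by the span of all $\mathrm{ad}(X)(f)$ with $X\in\mathfrak g$, where $\mathrm{ad}(X)$ is the derivation extending $Y\otimes v\mapsto[X,Y]\otimes v$. * $\sigma\colon\mathrm{Sym}(\mathfrak g\otimes\mathbb{k}^2)\cong\mathrm{Sym}(\mathfrak g)^{\otimes 2}\to U(\mathfrak g)^{\otimes 2}$ is the tensor square of the symmetrization map $X_1\cdots X_n\mapsto\frac1{n!}\sum_{\alpha\in S_n}X_{\alpha(1)}\cdots X_{\alpha(n)}$. * $p\colon\mathrm{Out}(F_2)\to\mathrm{GL}_2(\mathbb Z)$ is the natural homomorphism that sends the class of $\psi$ to the matrix whose $i$-th row is the exponent vector of $\psi^{-1}(x_i)$. (Classically, $p$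 is the identification $\mathrm{Out}(F_2)\cong\mathrm{GL}_2(\mathbb Z)$.) Then $p$ is surjective, $\sigma$ induces a well-defined linear isomorphism $$\overline\sigma\colon\overline{\mathrm{Sym}(\mathfrak g\otimes\mathbb{k}^2)}\longrightarrow\overline{U(\mathfrak g)^{\otimes 2}},$$ and $\overline\sigma(p(\psi)\cdot v)=\psi\cdot\overline\sigma(v)$ for all $\psi\in\mathrm{Out}(F_2)$ and all $v$. In particular the action of $\mathrm{Out}(F_2)$ on $\overline{U(\mathfrak g)^{\otimes 2}}$ factors through $p$, and $\overline\sigma$ is an isomorphism of $\mathrm{GL}_2(\mathbb Z)$-modules, with the standard linear action on the source. -/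

import Mathlib

noncomputable section

open scoped TensorProduct

/-! The Hopf algebra structure of the universal enveloping algebra. -/

namespace UniversalEnvelopingAlgebra

open Coalgebra

attribute [local instance 100] LieRing.ofAssociativeRing

variable (k : Type*) (g : Type*) [CommRing k] [LieRing g] [LieAlgebra k g]

/-- The Lie algebra map `X ↦ X ⊗ 1 + 1 ⊗ X`. -/
def primitiveHom : g →ₗ⁅k⁆ UniversalEnvelopingAlgebra k g ⊗[k] UniversalEnvelopingAlgebra k g where
  toFun x := ι k x ⊗ₜ[k] 1 + 1 ⊗ₜ[k] ι k x
  map_add' x y := by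
    rw [map_add, TensorProduct.add_tmul, TensorProduct.tmul_add]; abel
  map_smul' r x := by
    rw [map_smul, TensorProduct.tmul_smul, ← TensorProduct.smul_tmul', ← smul_add, RingHom.id_apply]
  map_lie' := by
    intro x y
    simp only [LieHom.map_lie, LieRing.of_associative_ring_bracket, mul_add, add_mul,
      TensorProduct.tmul_sub, TensorProduct.sub_tmul, Algebra.TensorProduct.tmul_mul_tmul,
      one_mul, mul_one]
    abel

/-- The Lie algebra map `X ↦ -X` into the opposite algebra. -/
def negOpHom : g →ₗ⁅k⁆ (UniversalEnvelopingAlgebra k g)ᵐᵒᵖ where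
  toFun x := MulOpposite.op (-ι k x)
  map_add' x y := by rw [map_add, neg_add, MulOpposite.op_add]
  map_smul' r x := by rw [map_smul, ← smul_neg, MulOpposite.op_smul, RingHom.id_apply]
  map_lie' := by
    intro x y
    simp only [LieHom.map_lie, LieRing.of_associative_ring_bracket, ← MulOpposite.op_mul,
      ← MulOpposite.op_sub, neg_mul_neg, neg_sub]

theorem primitiveHom_apply (x : g) : primitiveHom k g x = ι k x ⊗ₜ[k] 1 + 1 ⊗ₜ[k] ι k x := rfl

theorem negOpHom_apply (x : g) : negOpHom k g x = MulOpposite.op (-ι k x) := rfl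

/-- Comultiplication and counit, determined by `Δ X = X ⊗ 1 + 1 ⊗ X` and `ε X = 0`. -/
instance instBialgebra : Bialgebra k (UniversalEnvelopingAlgebra k g) :=
  .ofAlgHom (lift k (primitiveHom k g)) (lift k (0 : g →ₗ⁅k⁆ k))
    (by
      ext x
      simp [primitiveHom_apply, -ι_apply, lift_ι_apply, Algebra.TensorProduct.one_def, TensorProduct.add_tmul, TensorProduct.tmul_add]
      abel)
    (by
      have h : (Algebra.TensorProduct.lid k _).toAlgHom.comp ((Algebra.TensorProduct.map
          (lift k (0 : g →ₗ⁅k⁆ k)) (.id k _)).comp (lift k (primitiveHom k g))) =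
          .id k (UniversalEnvelopingAlgebra k g) := by
        ext x
        simp [primitiveHom_apply, -ι_apply, lift_ι_apply]
      refine AlgHom.ext fun a => ?_
      exact (Algebra.TensorProduct.lid k _).injective (by simpa using congr($h a)))
    (by ext x; simp [primitiveHom_apply, -ι_apply, lift_ι_apply])

theorem comul_ι (x : g) :
    comul (R := k) (ι k x) = ι k x ⊗ₜ[k] 1 + 1 ⊗ₜ[k] ι k x :=
  lift_ι_apply k _ x

theorem counit_ι (x : g) : counit (R := k) (ι k x) = 0 :=
  lift_ι_apply k _ x

instance instIsCocomm : IsCocomm k (UniversalEnvelopingAlgebra k g) where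
  comm_comp_comul := by
    have h : (Algebra.TensorProduct.comm k (UniversalEnvelopingAlgebra k g)
          (UniversalEnvelopingAlgebra k g)).toAlgHom.comp (Bialgebra.comulAlgHom k _) =
        Bialgebra.comulAlgHom k (UniversalEnvelopingAlgebra k g) := by
      ext x
      simp [comul_ι, -ι_apply]
      abel
    exact congr(($h).toLinearMap)

variable {k g} in
@[elab_as_elim]
theorem induction_mul {motive : UniversalEnvelopingAlgebra k g → Prop}
    (one : motive 1) (smul : ∀ (r : k) a, motive a → motive (r • a))
    (add : ∀ a b, motive a → motive b → motive (a + b))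
    (mul : ∀ (x : g) a, motive a → motive (ι k x * a))
    (a : UniversalEnvelopingAlgebra k g) : motive a := by
  have key : ∀ b : TensorAlgebra k g, ∀ a, motive a → motive (mkAlgHom k g b * a) := by
    intro b
    induction b using TensorAlgebra.induction with
    | algebraMap r =>
      intro a ha
      rw [AlgHom.commutes, ← Algebra.smul_def]
      exact smul r a ha
    | ι x => intro a ha; exact mul x a ha
    | mul b c hb hc => intro a ha; rw [map_mul, mul_assoc]; exact hb _ (hc _ ha)
    | add b c hb hc => intro a ha; rw [map_add, add_mul]; exact add _ _ (hb _ ha) (hc _ ha)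
  obtain ⟨b, rfl⟩ : ∃ b, mkAlgHom k g b = a := Quotient.mk_surjective a
  simpa using key b 1 one

/-- The antipode: the antiautomorphism with `S X = -X`. -/
def antipodeMap : UniversalEnvelopingAlgebra k g →ₗ[k] UniversalEnvelopingAlgebra k g :=
  (MulOpposite.opLinearEquiv k).symm.toLinearMap ∘ₗ (lift k (negOpHom k g)).toLinearMap

theorem antipodeMap_mul (a b : UniversalEnvelopingAlgebra k g) :
    antipodeMap k g (a * b) = antipodeMap k g b * antipodeMap k g a := by
  simp [antipodeMap]

theorem antipodeMap_one : antipodeMap k g 1 = 1 := by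
  simp [antipodeMap]

theorem antipodeMap_ι (x : g) : antipodeMap k g (ι k x) = -ι k x := by
  simp [antipodeMap, negOpHom_apply, -ι_apply, lift_ι_apply]

instance instHopfAlgebra : HopfAlgebra k (UniversalEnvelopingAlgebra k g) where
  antipode := antipodeMap k g
  mul_antipode_rTensor_comul := by
    ext a
    induction a using induction_mul with
    | one => simp [Algebra.TensorProduct.one_def, antipodeMap_one]
    | smul r a ha => 
      simp only [map_smul, ha]
    | add a b ha hb => simp only [map_add, ha, hb]
    | mul x a ha =>
      simp only [LinearMap.comp_apply, Bialgebra.comul_mul, Bialgebra.counit_mul, comul_ι, counit_ι, zero_mul, map_zero]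
      induction comul (R := k) a with
      | zero => simp
      | add s t hs ht => rw [mul_add, map_add, map_add, hs, ht, add_zero]
      | tmul s t => simp [add_mul, antipodeMap_mul, antipodeMap_ι, -ι_apply, mul_assoc]
  mul_antipode_lTensor_comul := by
    ext a
    induction a using induction_mul with
    | one => simp [Algebra.TensorProduct.one_def, antipodeMap_one]
    | smul r a ha => 
      simp only [map_smul, ha]
    | add a b ha hb => simp only [map_add, ha, hb]
    | mul x a ha =>
      have h2 : LinearMap.mul' k _ ((antipodeMap k g).lTensor _ (comul (R := k) a)) = algebraMap k _ (counit (R := k) a) := by simpa using ha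
      have h3 : ∀ t : UniversalEnvelopingAlgebra k g ⊗[k] UniversalEnvelopingAlgebra k g,
          LinearMap.mul' k _ ((antipodeMap k g).lTensor _ ((ι k x ⊗ₜ[k] 1 + 1 ⊗ₜ[k] ι k x) * t)) =
          ι k x * LinearMap.mul' k _ ((antipodeMap k g).lTensor _ t) - 
            LinearMap.mul' k _ ((antipodeMap k g).lTensor _ t) * ι k x := by
        intro t
        induction t with
        | zero => simp
        | add s t hs ht => rw [mul_add, map_add, map_add, hs, ht, map_add, map_add]; noncomm_ring
        | tmul s t => simp [add_mul, antipodeMap_mul, antipodeMap_ι, -ι_apply, mul_assoc]; noncomm_ring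
      simp only [LinearMap.comp_apply, Bialgebra.comul_mul, Bialgebra.counit_mul, comul_ι, counit_ι, zero_mul, map_zero]
      rw [h3, h2, Algebra.commutes, sub_self]

theorem antipode_ι (x : g) : HopfAlgebra.antipode k (ι k x) = -ι k x := antipodeMap_ι k g x

end UniversalEnvelopingAlgebra

/-! The action of `Aut(F₂)` and `Out(F₂)` for a cocommutative Hopf algebra `H`. -/

namespace HopfOut

open Coalgebra WithConv

theorem coalgHom_ext {k A B : Type*} [CommSemiring k] [AddCommMonoid A] [Module k A]
    [CoalgebraStruct k A] [AddCommMonoid B] [Module k B] [CoalgebraStruct k B]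
    {f g : A →ₗc[k] B} (h : f.toLinearMap = g.toLinearMap) : f = g :=
  CoalgHom.coe_linearMap_injective h

section Convolution

variable {k C B H : Type*} [CommRing k] [AddCommGroup C] [Module k C] [Coalgebra k C]
  [AddCommGroup B] [Module k B] [Coalgebra k B] [Ring H] [HopfAlgebra k H]

/-- A coalgebra map `a : C → H` is invertible for the convolution product, with inverse `S ∘ a`. -/
def convUnit (a : C →ₗc[k] H) : (WithConv (C →ₗ[k] H))ˣ where
  val := toConv a.toLinearMap
  inv := toConv (HopfAlgebra.antipode k ∘ₗ a.toLinearMap)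
  val_inv := by
    have h := LinearMap.convMul_comp_coalgHom_distrib (toConv (LinearMap.id (R := k) (M := H)))
      (toConv (HopfAlgebra.antipode k)) a
    rw [LinearMap.id_mul_antipode] at h
    have h' := congrArg toConv h
    simp only [LinearMap.id_comp, toConv_ofConv] at h'
    rw [← h']
    ext x
    simp
  inv_val := by
    have h := LinearMap.convMul_comp_coalgHom_distrib (toConv (HopfAlgebra.antipode k))
      (toConv (LinearMap.id (R := k) (M := H))) a
    rw [LinearMap.antipode_mul_id] at h
    have h' := congrArg toConv h
    simp only [LinearMap.id_comp, toConv_ofConv] at h'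
    rw [← h']
    ext x
    simp

/-- Evaluation of words of the free group on `x₀, x₁` in the convolution algebra `Hom(C, H)`,
with `x₀ ↦ a` and `x₁ ↦ b`. In Sweedler notation, the successive letters of `w` are replaced by
`a` or `b` (or `S ∘ a`, `S ∘ b` for inverse letters) applied to `c₍₁₎, c₍₂₎, …`, and the results
are multiplied. -/
def word (a b : C →ₗc[k] H) : FreeGroup (Fin 2) →* (WithConv (C →ₗ[k] H))ˣ :=
  FreeGroup.lift ![convUnit a, convUnit b]

/-- Precomposition with a coalgebra map, as a map of convolution algebras. -/
def precomp (f : B →ₗc[k] C) : WithConv (C →ₗ[k] H) →* WithConv (B →ₗ[k] H) where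
  toFun p := toConv (p.ofConv ∘ₗ f.toLinearMap)
  map_one' := by ext x; simp
  map_mul' p q := congrArg toConv (LinearMap.convMul_comp_coalgHom_distrib p q f)

theorem units_map_convUnit (f : B →ₗc[k] C) (a : C →ₗc[k] H) :
    Units.map (precomp f) (convUnit a) = convUnit (a.comp f) :=
  Units.ext rfl

theorem units_map_word (f : B →ₗc[k] C) (a b : C →ₗc[k] H) (w : FreeGroup (Fin 2)) :
    Units.map (precomp f) (word a b w) = word (a.comp f) (b.comp f) w := by
  have : (Units.map (precomp (H := H) f)).comp (word a b) = word (a.comp f) (b.comp f) := by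
    ext i : 1
    fin_cases i <;> simp [word, units_map_convUnit]
  exact congr($this w)

/-- Postcomposition with an algebra map. -/
def postcomp {A : Type*} [Ring A] [Algebra k A] (f : H →ₐ[k] A) :
    WithConv (C →ₗ[k] H) →* WithConv (C →ₗ[k] A) where
  toFun p := toConv (f.toLinearMap ∘ₗ p.ofConv)
  map_one' := by ext x; simp
  map_mul' p q := congrArg toConv (LinearMap.algHom_comp_convMul_distrib f p q)

theorem counit_comp_word (a b : C →ₗc[k] H) (w : FreeGroup (Fin 2)) :
    counit ∘ₗ (word a b w).val.ofConv = counit (R := k) := by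
  have : (Units.map (postcomp (Bialgebra.counitAlgHom k H))).comp (word a b) = 1 := by
    ext i : 1
    have key (c : C →ₗc[k] H) : Units.map (postcomp (Bialgebra.counitAlgHom k H)) (convUnit c) = 1 :=
      Units.ext (congrArg toConv c.counit_comp)
    fin_cases i <;> simp [word, key]
  exact congrArg (fun u => u.val.ofConv) congr($this w)

variable [IsCocomm k C]

/-- `p ↦ (p ⊗ p) ∘ Δ`, as a map of convolution monoids. -/
def diag : WithConv (C →ₗ[k] H) →* WithConv (C →ₗ[k] H ⊗[k] H) where
  toFun p := toConv (TensorProduct.map p.ofConv p.ofConv ∘ₗ comul)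
  map_one' := by
    ext x
    have : TensorProduct.map (1 : WithConv (C →ₗ[k] H)).ofConv (1 : WithConv (C →ₗ[k] H)).ofConv =
      (Algebra.linearMap k (H ⊗[k] H)) ∘ₗ (counit (R := k) (A := C ⊗[k] C)) := by
      ext x y
      simp [LinearMap.convOne_def, Algebra.algebraMap_eq_smul_one, Algebra.TensorProduct.one_def,
        TensorProduct.smul_tmul', TensorProduct.tmul_smul, smul_smul, mul_comm]
    simp only [this]
    have h := congr($((comulCoalgHom k C).counit_comp) x)
    exact congrArg (algebraMap k (H ⊗[k] H)) h
  map_mul' p q := by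
    have h1 := TensorProduct.map_convMul_map (R := k) (f := p) (g := p) (h := q) (k := q)
    have h2 := LinearMap.convMul_comp_coalgHom_distrib
      (toConv (TensorProduct.map p.ofConv p.ofConv)) (toConv (TensorProduct.map q.ofConv q.ofConv))
      (comulCoalgHom k C)
    rw [h1] at h2
    exact congrArg toConv h2

theorem comul_comp_word (a b : C →ₗc[k] H) (w : FreeGroup (Fin 2)) :
    TensorProduct.map (word a b w).val.ofConv (word a b w).val.ofConv ∘ₗ comul =
      comul ∘ₗ (word a b w).val.ofConv := by
  have : (Units.map (diag (k := k) (C := C) (H := H))).comp (word a b) =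
      (Units.map (postcomp (Bialgebra.comulAlgHom k H))).comp (word a b) := by
    ext i : 1
    have key (c : C →ₗc[k] H) : Units.map (diag (k := k) (C := C) (H := H)) (convUnit c) =
        Units.map (postcomp (Bialgebra.comulAlgHom k H)) (convUnit c) :=
      Units.ext (congrArg toConv c.map_comp_comul)
    fin_cases i <;> simp [word, key]
  exact congrArg (fun u => u.val.ofConv) congr($this w)

/-- The evaluation of a word on a cocommutative coalgebra is again a coalgebra map. -/
def wordHom (a b : C →ₗc[k] H) (w : FreeGroup (Fin 2)) : C →ₗc[k] H where
  toLinearMap := (word a b w).val.ofConv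
  counit_comp := counit_comp_word a b w
  map_comp_comul := comul_comp_word a b w

theorem toLinearMap_wordHom (a b : C →ₗc[k] H) (w : FreeGroup (Fin 2)) :
    (wordHom a b w).toLinearMap = (word a b w).val.ofConv := rfl

theorem convUnit_wordHom (a b : C →ₗc[k] H) (w : FreeGroup (Fin 2)) :
    convUnit (wordHom a b w) = word a b w :=
  Units.ext rfl

theorem wordHom_of (a b : C →ₗc[k] H) (i : Fin 2) :
    wordHom a b (FreeGroup.of i) = ![a, b] i := by
  refine coalgHom_ext ?_
  rw [toLinearMap_wordHom, word, FreeGroup.lift_apply_of]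
  fin_cases i <;> rfl

/-- Substituting words into a word. -/
theorem word_wordHom (a b : C →ₗc[k] H) (u v w : FreeGroup (Fin 2)) :
    word (wordHom a b u) (wordHom a b v) w = word a b (FreeGroup.lift ![u, v] w) := by
  have : word (wordHom a b u) (wordHom a b v) = (word a b).comp (FreeGroup.lift ![u, v]) := by
    ext i : 1
    fin_cases i
    · simpa [word] using convUnit_wordHom a b u
    · simpa [word] using convUnit_wordHom a b v
  exact congr($this w)

theorem wordHom_wordHom (a b : C →ₗc[k] H) (u v w : FreeGroup (Fin 2)) :
    wordHom (wordHom a b u) (wordHom a b v) w = wordHom a b (FreeGroup.lift ![u, v] w) :=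
  coalgHom_ext (by simp only [toLinearMap_wordHom, word_wordHom])

theorem wordHom_comp [IsCocomm k B] (f : B →ₗc[k] C) (a b : C →ₗc[k] H) (w : FreeGroup (Fin 2)) :
    (wordHom a b w).comp f = wordHom (a.comp f) (b.comp f) w :=
  coalgHom_ext congr(($(units_map_word f a b w)).val.ofConv)

end Convolution

section Pair

variable {k C B A H : Type*} [CommRing k] [AddCommGroup C] [Module k C] [Coalgebra k C]
  [IsCocomm k C] [AddCommGroup B] [Module k B] [Coalgebra k B]
  [AddCommGroup A] [Module k A] [Coalgebra k A] [AddCommGroup H] [Module k H] [Coalgebra k H]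

/-- The coalgebra map `c ↦ p c₍₁₎ ⊗ q c₍₂₎`. -/
def pair (p : C →ₗc[k] A) (q : C →ₗc[k] H) : C →ₗc[k] A ⊗[k] H :=
  (Coalgebra.TensorProduct.map p q).comp (comulCoalgHom k C)

theorem pair_comp [IsCocomm k B] (p : C →ₗc[k] A) (q : C →ₗc[k] H) (f : B →ₗc[k] C) :
    (pair p q).comp f = pair (p.comp f) (q.comp f) := by
  refine coalgHom_ext ?_
  change (TensorProduct.map p.toLinearMap q.toLinearMap ∘ₗ comul) ∘ₗ f.toLinearMap =
    TensorProduct.map (p.toLinearMap ∘ₗ f.toLinearMap) (q.toLinearMap ∘ₗ f.toLinearMap) ∘ₗ comul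
  rw [LinearMap.comp_assoc, ← f.map_comp_comul, TensorProduct.map_comp, LinearMap.comp_assoc]

/-- The projection `a ⊗ h ↦ ε(h) a`. -/
def fstHom (k A H : Type*) [CommRing k] [AddCommGroup A] [Module k A] [Coalgebra k A]
    [AddCommGroup H] [Module k H] [Coalgebra k H] : A ⊗[k] H →ₗc[k] A :=
  (Coalgebra.TensorProduct.rid k k A).toCoalgHom.comp
    (Coalgebra.TensorProduct.map (.id k A) (counitCoalgHom k H))

/-- The projection `a ⊗ h ↦ ε(a) h`. -/
def sndHom (k A H : Type*) [CommRing k] [AddCommGroup A] [Module k A] [Coalgebra k A]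
    [AddCommGroup H] [Module k H] [Coalgebra k H] : A ⊗[k] H →ₗc[k] H :=
  (Coalgebra.TensorProduct.lid k H).toCoalgHom.comp
    (Coalgebra.TensorProduct.map (counitCoalgHom k A) (.id k H))

theorem fstHom_tmul (a : A) (h : H) : fstHom k A H (a ⊗ₜ h) = counit (R := k) h • a := rfl

theorem sndHom_tmul (a : A) (h : H) : sndHom k A H (a ⊗ₜ h) = counit (R := k) a • h := rfl

theorem fstHom_comp_pair (p : C →ₗc[k] A) (q : C →ₗc[k] H) :
    (fstHom k A H).comp (pair p q) = p := by
  refine coalgHom_ext ?_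
  have h1 : (fstHom k A H).toLinearMap ∘ₗ TensorProduct.map p.toLinearMap q.toLinearMap =
      p.toLinearMap ∘ₗ (TensorProduct.rid k C).toLinearMap ∘ₗ (counit (R := k)).lTensor C := by
    ext x y
    have h2 : counit (R := k) (q y) = counit (R := k) y := congr($(q.counit_comp) y)
    simp [fstHom_tmul, h2]
  change (fstHom k A H).toLinearMap ∘ₗ (TensorProduct.map p.toLinearMap q.toLinearMap ∘ₗ comul) =
    p.toLinearMap
  rw [← LinearMap.comp_assoc, h1, LinearMap.comp_assoc, LinearMap.comp_assoc,
    lTensor_counit_comp_comul]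
  ext x
  simp

theorem sndHom_comp_pair (p : C →ₗc[k] A) (q : C →ₗc[k] H) :
    (sndHom k A H).comp (pair p q) = q := by
  refine coalgHom_ext ?_
  have h1 : (sndHom k A H).toLinearMap ∘ₗ TensorProduct.map p.toLinearMap q.toLinearMap =
      q.toLinearMap ∘ₗ (TensorProduct.lid k C).toLinearMap ∘ₗ (counit (R := k)).rTensor C := by
    ext x y
    have h2 : counit (R := k) (p x) = counit (R := k) x := congr($(p.counit_comp) x)
    simp [sndHom_tmul, h2]
  change (sndHom k A H).toLinearMap ∘ₗ (TensorProduct.map p.toLinearMap q.toLinearMap ∘ₗ comul) =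
    q.toLinearMap
  rw [← LinearMap.comp_assoc, h1, LinearMap.comp_assoc, LinearMap.comp_assoc,
    rTensor_counit_comp_comul]
  ext x
  simp

theorem pair_fstHom_sndHom [IsCocomm k A] [IsCocomm k H] :
    pair (fstHom k A H) (sndHom k A H) = .id k (A ⊗[k] H) := by
  refine coalgHom_ext ?_
  ext a h
  change TensorProduct.map (fstHom k A H).toLinearMap (sndHom k A H).toLinearMap
    (comul (R := k) (a ⊗ₜ[k] h)) = a ⊗ₜ h
  have e1 := sum_tmul_counit_eq (ℛ k a)
  have e2 := sum_counit_tmul_eq (ℛ k h)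
  apply_fun TensorProduct.rid k A at e1
  apply_fun TensorProduct.lid k H at e2
  rw [TensorProduct.rid_tmul, one_smul, map_sum] at e1
  rw [TensorProduct.lid_tmul, one_smul, map_sum] at e2
  conv_rhs => rw [← e1, ← e2]
  rw [TensorProduct.comul_tmul, ← (ℛ k a).eq, ← (ℛ k h).eq]
  simp only [TensorProduct.sum_tmul, TensorProduct.tmul_sum, map_sum]
  refine Finset.sum_congr rfl fun i _ => Finset.sum_congr rfl fun j _ => ?_
  simp [fstHom_tmul, sndHom_tmul, TensorProduct.smul_tmul', TensorProduct.tmul_smul, smul_smul,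
    mul_comm]

end Pair

section Action

variable (k H : Type*) [CommRing k] [Ring H] [HopfAlgebra k H]

/-- The adjoint action `h ↦ (a ↦ h₍₁₎ a S(h₍₂₎))`. -/
def adjoint : H →ₗ[k] H →ₗ[k] H :=
  TensorProduct.lift ((LinearMap.llcomp k H H H).compl₁₂ (LinearMap.mul k H)
    ((LinearMap.mul k H).flip ∘ₗ HopfAlgebra.antipode k)) ∘ₗ comul

/-- The conjugation action `h ⊛ (a ⊗ b) = h₍₁₎ a S(h₍₂₎) ⊗ h₍₃₎ b S(h₍₄₎)`. -/
def conjAct : H →ₗ[k] H ⊗[k] H →ₗ[k] H ⊗[k] H :=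
  TensorProduct.homTensorHomMap (.id k) H H H H ∘ₗ
    TensorProduct.map (adjoint k H) (adjoint k H) ∘ₗ comul

/-- The subspace spanned by the elements `(h - ε(h) 1) ⊛ (a ⊗ b)`. -/
def conjSpan : Submodule k (H ⊗[k] H) :=
  Submodule.span k {y | ∃ h a b : H,
    y = conjAct k H (h - algebraMap k H (counit (R := k) h)) (a ⊗ₜ[k] b)}

/-- The quotient of `H ⊗ H` on which the conjugation action factors through the counit. -/
abbrev HBar : Type _ := (H ⊗[k] H) ⧸ conjSpan k H

theorem conjAct_sub_mem (h : H) (t : H ⊗[k] H) :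
    conjAct k H (h - algebraMap k H (counit (R := k) h)) t ∈ conjSpan k H := by
  induction t with
  | zero => rw [map_zero]; exact zero_mem _
  | add s t hs ht => rw [map_add]; exact add_mem hs ht
  | tmul a b => exact Submodule.subset_span ⟨h, a, b, rfl⟩

theorem one_conjAct (t : H ⊗[k] H) : conjAct k H 1 t = t := by
  have h1 : adjoint k H 1 = .id := by
    ext a
    simp [adjoint, Algebra.TensorProduct.one_def]
  simp [conjAct, Algebra.TensorProduct.one_def, h1]

/-- The word `x₀ x₁ x₀⁻¹`. -/
def conjWord : FreeGroup (Fin 2) := .of 0 * .of 1 * (.of 0)⁻¹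

theorem word_conjWord {C : Type*} [AddCommGroup C] [Module k C] [Coalgebra k C]
    (z x : C →ₗc[k] H) :
    word z x conjWord = convUnit z * convUnit x * (convUnit z)⁻¹ := by
  simp [word, conjWord]

/-- Conjugating a pair of elements conjugates the value of every word. -/
theorem wordHom_conjWord {C : Type*} [AddCommGroup C] [Module k C] [Coalgebra k C] [IsCocomm k C]
    (z x y : C →ₗc[k] H) (w : FreeGroup (Fin 2)) :
    wordHom (wordHom z x conjWord) (wordHom z y conjWord) w =
      wordHom z (wordHom x y w) conjWord := by
  have : word (wordHom z x conjWord) (wordHom z y conjWord) =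
      (MulAut.conj (convUnit z)).toMonoidHom.comp (word x y) := by
    ext i : 1
    fin_cases i
    · simp [word, convUnit_wordHom, conjWord]
    · simp [word, convUnit_wordHom, conjWord]
  refine coalgHom_ext ?_
  rw [toLinearMap_wordHom, toLinearMap_wordHom, this, word_conjWord, convUnit_wordHom]
  rfl

variable [IsCocomm k H]

/-- The map `H ⊗ H → H ⊗ H` that evaluates the pair of words `(u, v)`: the value at `h₀ ⊗ h₁` is
`u ⊗ v` with the successive occurrences of `x_i^{±1}` in `u, v` replaced by
`(h_i)₍₁₎, (h_i)₍₂₎, …`, with the antipode applied for the exponent `-1`. -/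
def evalWords (u v : FreeGroup (Fin 2)) : H ⊗[k] H →ₗc[k] H ⊗[k] H :=
  pair (wordHom (fstHom k H H) (sndHom k H H) u) (wordHom (fstHom k H H) (sndHom k H H) v)

theorem evalWords_comp (u v u' v' : FreeGroup (Fin 2)) :
    (evalWords k H u v).comp (evalWords k H u' v') =
      evalWords k H (FreeGroup.lift ![u', v'] u) (FreeGroup.lift ![u', v'] v) := by
  simp only [evalWords, pair_comp, wordHom_comp, fstHom_comp_pair, sndHom_comp_pair,
    wordHom_wordHom]

/-- The action of `Aut(F₂)` on `H ⊗ H`. The tensor `h₀ ⊗ h₁` represents the value at the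
generators `(x₀, x₁)` and `ψ` sends it to the value at `(ψ⁻¹ x₀, ψ⁻¹ x₁)`. -/
def rhoAut : Representation k (MulAut (FreeGroup (Fin 2))) (H ⊗[k] H) where
  toFun ψ := (evalWords k H (ψ⁻¹ (.of 0)) (ψ⁻¹ (.of 1))).toLinearMap
  map_one' := by
    have : evalWords k H (.of 0) (.of 1) = .id k (H ⊗[k] H) := by
      simp only [evalWords, wordHom_of, Matrix.cons_val_zero, Matrix.cons_val_one,
        pair_fstHom_sndHom]
    exact congrArg CoalgHom.toLinearMap this
  map_mul' ψ₁ ψ₂ := by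
    have h : ∀ w, FreeGroup.lift ![ψ₂⁻¹ (.of 0), ψ₂⁻¹ (.of 1)] w = ψ₂⁻¹ w := by
      intro w
      have : FreeGroup.lift ![ψ₂⁻¹ (.of 0), ψ₂⁻¹ (.of 1)] = (ψ₂⁻¹).toMonoidHom := by
        ext i : 1
        fin_cases i <;> simp
      exact congr($this w)
    have := evalWords_comp k H (ψ₁⁻¹ (.of 0)) (ψ₁⁻¹ (.of 1)) (ψ₂⁻¹ (.of 0)) (ψ₂⁻¹ (.of 1))
    rw [h, h] at this
    rw [mul_inv_rev]
    exact congrArg CoalgHom.toLinearMap this.symm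

/- Compatibility of the action of `Aut(F₂)` with conjugation. -/

theorem wordHom_conjWord_tmul (f : H ⊗[k] H →ₗc[k] H) (h : H) (t : H ⊗[k] H) :
    wordHom (fstHom k H (H ⊗[k] H)) (f.comp (sndHom k H (H ⊗[k] H))) conjWord (h ⊗ₜ t) =
      adjoint k H h (f t) := by
  have h1 : pair (fstHom k H (H ⊗[k] H)) (f.comp (sndHom k H (H ⊗[k] H))) =
      Coalgebra.TensorProduct.map (.id k H) f := by
    have h2 : pair (fstHom k H (H ⊗[k] H)) (f.comp (sndHom k H (H ⊗[k] H))) =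
        (Coalgebra.TensorProduct.map (.id k H) f).comp
          (pair (fstHom k H (H ⊗[k] H)) (sndHom k H (H ⊗[k] H))) := by
      refine coalgHom_ext ?_
      change TensorProduct.map _ (f.toLinearMap ∘ₗ _) ∘ₗ comul =
        TensorProduct.map .id f.toLinearMap ∘ₗ TensorProduct.map _ _ ∘ₗ comul
      rw [← LinearMap.comp_assoc, ← TensorProduct.map_comp, LinearMap.id_comp]
      rfl
    rw [h2, pair_fstHom_sndHom]
    rfl
  have h3 : ((convUnit (fstHom k H (H ⊗[k] H))).val *
      (convUnit (f.comp (sndHom k H (H ⊗[k] H)))).val).ofConv =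
      LinearMap.mul' k H ∘ₗ TensorProduct.map .id f.toLinearMap :=
    congr(LinearMap.mul' k H ∘ₗ ($h1).toLinearMap)
  have h4 : (wordHom (fstHom k H (H ⊗[k] H)) (f.comp (sndHom k H (H ⊗[k] H)))
      conjWord).toLinearMap = LinearMap.mul' k H ∘ₗ
        TensorProduct.map (LinearMap.mul' k H ∘ₗ TensorProduct.map .id f.toLinearMap)
          (HopfAlgebra.antipode k ∘ₗ (fstHom k H (H ⊗[k] H)).toLinearMap) ∘ₗ comul := by
    rw [toLinearMap_wordHom, word_conjWord, ← h3]
    rfl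
  have h5 := congr($h4 (h ⊗ₜ[k] t))
  refine h5.trans ?_
  have e1 := sum_tmul_counit_eq (ℛ k t)
  apply_fun TensorProduct.rid k _ at e1
  rw [TensorProduct.rid_tmul, one_smul, map_sum] at e1
  conv_rhs => rw [← e1]
  simp only [LinearMap.comp_apply, adjoint]
  rw [TensorProduct.comul_tmul, ← (ℛ k h).eq, ← (ℛ k t).eq]
  simp only [TensorProduct.sum_tmul, TensorProduct.tmul_sum, map_sum, LinearMap.sum_apply]
  refine Finset.sum_congr rfl fun i _ => ?_
  refine Finset.sum_congr rfl fun j _ => ?_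
  simp [fstHom_tmul, mul_assoc]

/-- The conjugation action as a coalgebra map `H ⊗ (H ⊗ H) → H ⊗ H`. -/
def conjHom : H ⊗[k] (H ⊗[k] H) →ₗc[k] H ⊗[k] H :=
  pair (wordHom (fstHom k H _) ((fstHom k H H).comp (sndHom k H _)) conjWord)
    (wordHom (fstHom k H _) ((sndHom k H H).comp (sndHom k H _)) conjWord)

theorem conjHom_tmul (h : H) (t : H ⊗[k] H) : conjHom k H (h ⊗ₜ t) = conjAct k H h t := by
  have h1 : pair (fstHom k H H) (sndHom k H H) t = t :=
    DFunLike.congr_fun pair_fstHom_sndHom t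
  conv_rhs => rw [← h1]
  change TensorProduct.map (wordHom (fstHom k H _) ((fstHom k H H).comp (sndHom k H _))
    conjWord).toLinearMap (wordHom (fstHom k H _) ((sndHom k H H).comp (sndHom k H _))
    conjWord).toLinearMap (comul (h ⊗ₜ t)) = TensorProduct.homTensorHomMap _ _ _ _ _
      (TensorProduct.map (adjoint k H) (adjoint k H) (comul h))
      (TensorProduct.map (fstHom k H H).toLinearMap (sndHom k H H).toLinearMap (comul t))
  rw [TensorProduct.comul_tmul, ← (ℛ k h).eq, ← (ℛ k t).eq]
  simp only [TensorProduct.sum_tmul, TensorProduct.tmul_sum, map_sum, LinearMap.sum_apply]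
  refine Finset.sum_congr rfl fun i _ => ?_
  refine Finset.sum_congr rfl fun j _ => ?_
  simp [wordHom_conjWord_tmul]

theorem evalWords_conjAct (u v : FreeGroup (Fin 2)) (h : H) (t : H ⊗[k] H) :
    evalWords k H u v (conjAct k H h t) = conjAct k H h (evalWords k H u v t) := by
  have key : (evalWords k H u v).comp (conjHom k H) =
      (conjHom k H).comp (Coalgebra.TensorProduct.map (.id k H) (evalWords k H u v)) := by
    have h1 : (fstHom k H (H ⊗[k] H)).comp
        (Coalgebra.TensorProduct.map (.id k H) (evalWords k H u v)) = fstHom k H (H ⊗[k] H) := by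
      refine coalgHom_ext ?_
      ext a b c
      have : counit (R := k) (evalWords k H u v (b ⊗ₜ c)) = counit (R := k) (b ⊗ₜ[k] c) :=
        LinearMap.congr_fun (evalWords k H u v).counit_comp (b ⊗ₜ c)
      change fstHom k H (H ⊗[k] H) (a ⊗ₜ evalWords k H u v (b ⊗ₜ c)) =
        fstHom k H (H ⊗[k] H) (a ⊗ₜ (b ⊗ₜ c))
      rw [fstHom_tmul, fstHom_tmul, this]
    have h2 : (sndHom k H (H ⊗[k] H)).comp
        (Coalgebra.TensorProduct.map (.id k H) (evalWords k H u v)) =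
        (evalWords k H u v).comp (sndHom k H (H ⊗[k] H)) := by
      refine coalgHom_ext ?_
      ext a b c
      change sndHom k H (H ⊗[k] H) (a ⊗ₜ evalWords k H u v (b ⊗ₜ c)) =
        evalWords k H u v (sndHom k H (H ⊗[k] H) (a ⊗ₜ (b ⊗ₜ c)))
      rw [sndHom_tmul, sndHom_tmul, map_smul]
    have h3 (f : H ⊗[k] H →ₗc[k] H) : (f.comp (sndHom k H (H ⊗[k] H))).comp
        (Coalgebra.TensorProduct.map (.id k H) (evalWords k H u v)) =
        (f.comp (evalWords k H u v)).comp (sndHom k H (H ⊗[k] H)) := by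
      rw [CoalgHom.comp_assoc, h2, CoalgHom.comp_assoc]
    have h4 : (evalWords k H u v).comp (conjHom k H) = _ := pair_comp _ _ (conjHom k H)
    rw [h4, wordHom_comp, wordHom_comp]
    conv_rhs => rw [conjHom, pair_comp, wordHom_comp, wordHom_comp, h1, h3, h3]
    rw [conjHom, fstHom_comp_pair, sndHom_comp_pair, wordHom_conjWord, wordHom_conjWord,
      ← wordHom_comp, ← wordHom_comp, evalWords, fstHom_comp_pair, sndHom_comp_pair]
  have := congr($key (h ⊗ₜ t))
  change evalWords k H u v (conjHom k H (h ⊗ₜ t)) = conjHom k H (h ⊗ₜ evalWords k H u v t) at this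
  rwa [conjHom_tmul, conjHom_tmul] at this

theorem rhoAut_conjSpan (ψ : MulAut (FreeGroup (Fin 2))) :
    conjSpan k H ≤ (conjSpan k H).comap (rhoAut k H ψ) := by
  refine Submodule.span_le.2 ?_
  rintro _ ⟨h, a, b, rfl⟩
  have : rhoAut k H ψ (conjAct k H (h - algebraMap k H (counit (R := k) h)) (a ⊗ₜ[k] b)) = _ :=
    evalWords_conjAct k H _ _ _ _
  change rhoAut k H ψ _ ∈ conjSpan k H
  rw [this]
  exact conjAct_sub_mem k H h _

/-- The induced action of `Aut(F₂)` on the quotient. -/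
def rhoAutBar : Representation k (MulAut (FreeGroup (Fin 2))) (HBar k H) where
  toFun ψ := (conjSpan k H).mapQ (conjSpan k H) (rhoAut k H ψ) (rhoAut_conjSpan k H ψ)
  map_one' := by
    refine Submodule.linearMap_qext _ (LinearMap.ext fun t => ?_)
    simp
  map_mul' ψ₁ ψ₂ := by
    refine Submodule.linearMap_qext _ (LinearMap.ext fun t => ?_)
    simp

theorem rhoAut_conj (w : FreeGroup (Fin 2)) (t : H ⊗[k] H) :
    rhoAut k H (MulAut.conj w) t - t ∈ conjSpan k H := by
  set f := pair (wordHom (fstHom k H H) (sndHom k H H) w⁻¹) (.id k (H ⊗[k] H)) with hf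
  have h1 : rhoAut k H (MulAut.conj w) t = conjHom k H (f t) := by
    have h2 : (conjHom k H).comp f = evalWords k H (w⁻¹ * .of 0 * w) (w⁻¹ * .of 1 * w) := by
      rw [conjHom, pair_comp, wordHom_comp, wordHom_comp, CoalgHom.comp_assoc, CoalgHom.comp_assoc,
        hf, fstHom_comp_pair, sndHom_comp_pair, evalWords]
      have h3 (i : Fin 2) (g : H ⊗[k] H →ₗc[k] H) (hg : g = ![fstHom k H H, sndHom k H H] i) :
          wordHom (wordHom (fstHom k H H) (sndHom k H H) w⁻¹) (g.comp (.id k _)) conjWord =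
          wordHom (fstHom k H H) (sndHom k H H) (w⁻¹ * .of i * w) := by
        rw [CoalgHom.comp_id, hg, ← wordHom_of, wordHom_wordHom]
        congr 1
        simp [conjWord]
      rw [h3 0 (fstHom k H H) rfl, h3 1 (sndHom k H H) rfl]
    have h4 : rhoAut k H (MulAut.conj w) =
        (evalWords k H (w⁻¹ * .of 0 * w) (w⁻¹ * .of 1 * w)).toLinearMap := by
      change (evalWords k H ((MulAut.conj w)⁻¹ (.of 0)) ((MulAut.conj w)⁻¹ (.of 1))).toLinearMap = _
      simp only [← map_inv, MulAut.conj_apply, inv_inv]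
    rw [h4, ← h2]
    rfl
  have h5 : ∀ s : H ⊗[k] (H ⊗[k] H), conjHom k H s - sndHom k H (H ⊗[k] H) s ∈ conjSpan k H := by
    intro s
    induction s with
    | zero => simp
    | add s t hs ht => rw [map_add, map_add, add_sub_add_comm]; exact add_mem hs ht
    | tmul h t =>
      have := conjAct_sub_mem k H h t
      rwa [map_sub, Algebra.algebraMap_eq_smul_one, map_smul, LinearMap.sub_apply,
        LinearMap.smul_apply, one_conjAct, ← conjHom_tmul] at this
  have h6 : sndHom k H (H ⊗[k] H) (f t) = t :=
    DFunLike.congr_fun (sndHom_comp_pair (wordHom (fstHom k H H) (sndHom k H H) w⁻¹) (.id k _)) t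
  have := h5 (f t)
  rwa [h6, ← h1] at this

end Action

section Out

/-- The group of inner automorphisms. -/
abbrev Inn (G : Type*) [Group G] : Subgroup (MulAut G) := (MulAut.conj (G := G)).range

instance (G : Type*) [Group G] : (Inn G).Normal where
  conj_mem := by
    rintro _ ⟨x, rfl⟩ ψ
    refine ⟨ψ x, ?_⟩
    ext y
    simp

/-- The outer automorphism group. -/
abbrev Out (G : Type*) [Group G] : Type _ := MulAut G ⧸ Inn G

variable (k H : Type*) [CommRing k] [Ring H] [HopfAlgebra k H] [IsCocomm k H]

/-- The action of `Out(F₂)` on the quotient of `H ⊗ H` by conjugation. -/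
def rhoOut : Representation k (Out (FreeGroup (Fin 2))) (HBar k H) :=
  QuotientGroup.lift (Inn (FreeGroup (Fin 2))) (rhoAutBar k H) (by
    rintro _ ⟨w, rfl⟩
    refine Submodule.linearMap_qext _ (LinearMap.ext fun t => ?_)
    exact (Submodule.Quotient.eq _).2 (rhoAut_conj k H w t))

/-- The exponent vector of a word. -/
def expVec : FreeGroup (Fin 2) →* Multiplicative (Fin 2 → ℤ) :=
  FreeGroup.lift fun i => .ofAdd (Pi.single i 1)

/-- The matrix whose `i`-th row is the exponent vector of `φ x_i`. -/
def expMatrix (φ : FreeGroup (Fin 2) →* FreeGroup (Fin 2)) : Matrix (Fin 2) (Fin 2) ℤ :=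
  .of fun i => (expVec (φ (.of i))).toAdd

theorem expVec_map (φ : FreeGroup (Fin 2) →* FreeGroup (Fin 2)) (w : FreeGroup (Fin 2)) :
    (expVec (φ w)).toAdd = Matrix.vecMul (expVec w).toAdd (expMatrix φ) := by
  have : expVec.comp φ = (AddMonoidHom.toMultiplicative
      (Matrix.vecMulLinear (expMatrix φ)).toAddMonoidHom).comp expVec := by
    ext i : 1
    simp [expVec, expMatrix]
  exact congr(($this w).toAdd)

/-- The homomorphism `Aut(F₂) → GL₂(ℤ)`: the `i`-th row of the image of `ψ` is the exponent vector
of `ψ⁻¹ x_i`. -/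
def autToGL : MulAut (FreeGroup (Fin 2)) →* GL (Fin 2) ℤ :=
  MonoidHom.toHomUnits
    { toFun := fun ψ => expMatrix (ψ⁻¹).toMonoidHom
      map_one' := by
        ext i j
        simp [expMatrix, expVec, Matrix.one_apply, Pi.single_apply, eq_comm]
      map_mul' := fun ψ₁ ψ₂ => by
        ext i j
        have := expVec_map (ψ₂⁻¹).toMonoidHom ((ψ₁⁻¹) (.of i))
        rw [mul_inv_rev]
        exact congr($this j) }

/-- The homomorphism `Out(F₂) → GL₂(ℤ)` induced by `autToGL`. -/
def outToGL : Out (FreeGroup (Fin 2)) →* GL (Fin 2) ℤ :=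
  QuotientGroup.lift (Inn (FreeGroup (Fin 2))) autToGL (by
    rintro _ ⟨w, rfl⟩
    refine Units.ext ?_
    ext i j
    change (expVec ((MulAut.conj w)⁻¹ (.of i))).toAdd j = (1 : Matrix (Fin 2) (Fin 2) ℤ) i j
    rw [← map_inv, MulAut.conj_apply]
    simp [expVec, Matrix.one_apply, Pi.single_apply, eq_comm])

end Out
end HopfOut

/-! The symmetric algebra side and the symmetrization map. -/

namespace HopfOut

section SymmetricAlgebra

variable {k M N : Type*} [CommRing k] [AddCommGroup M] [Module k M] [AddCommGroup N] [Module k N]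

/-- The algebra map `Sym(M) → Sym(N)` induced by a linear map. -/
def symMap (f : M →ₗ[k] N) : SymmetricAlgebra k M →ₐ[k] SymmetricAlgebra k N :=
  SymmetricAlgebra.lift (SymmetricAlgebra.ι k N ∘ₗ f)

@[simp]
theorem symMap_ι (f : M →ₗ[k] N) (m : M) :
    symMap f (SymmetricAlgebra.ι k M m) = SymmetricAlgebra.ι k N (f m) := by
  simp [symMap]

/-- The algebra map `a ↦ a + D(a) ε` into the dual numbers over `Sym(M)`, where `D` extends `φ`. -/
def symDerAux (φ : M →ₗ[k] M) :
    SymmetricAlgebra k M →ₐ[k] TrivSqZeroExt (SymmetricAlgebra k M) (SymmetricAlgebra k M) :=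
  SymmetricAlgebra.lift
    { toFun := fun m => .inl (SymmetricAlgebra.ι k M m) + .inr (SymmetricAlgebra.ι k M (φ m))
      map_add' := fun x y => by ext <;> simp
      map_smul' := fun r x => by ext <;> simp }

theorem fst_symDerAux (φ : M →ₗ[k] M) (a : SymmetricAlgebra k M) : (symDerAux φ a).fst = a := by
  have : (TrivSqZeroExt.fstHom k (SymmetricAlgebra k M) (SymmetricAlgebra k M)).comp
      (symDerAux φ) = .id k _ := by
    ext m
    simp [symDerAux]
  exact congr($this a)

/-- The derivation of `Sym(M)` extending a linear endomorphism of `M` by the Leibniz rule. -/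
def symDer (φ : M →ₗ[k] M) : Derivation k (SymmetricAlgebra k M) (SymmetricAlgebra k M) where
  toFun a := (symDerAux φ a).snd
  map_add' a b := by simp
  map_smul' r a := by simp
  map_one_eq_zero' := by simp
  leibniz' a b := by simp [fst_symDerAux, mul_comm]

@[simp]
theorem symDer_ι (φ : M →ₗ[k] M) (m : M) :
    symDer φ (SymmetricAlgebra.ι k M m) = SymmetricAlgebra.ι k M (φ m) := by
  change (symDerAux φ (SymmetricAlgebra.ι k M m)).snd = _
  simp [symDerAux]

theorem symDer_symMap (φ : M →ₗ[k] M) (ψ : N →ₗ[k] N) (f : M →ₗ[k] N) (h : ψ ∘ₗ f = f ∘ₗ φ)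
    (a : SymmetricAlgebra k M) : symDer ψ (symMap f a) = symMap f (symDer φ a) := by
  induction a using SymmetricAlgebra.induction with
  | algebraMap r => simp
  | ι x => simpa using congr(SymmetricAlgebra.ι k N ($h x))
  | mul a b ha hb => simp [ha, hb]
  | add a b ha hb => simp [ha, hb]

end SymmetricAlgebra

section Symmetrization

variable {k M A : Type*} [Field k] [AddCommGroup M] [Module k M] [Ring A] [Algebra k A]

/-- The multilinear map `(m₁, …, mₙ) ↦ (1/n!) ∑_α f(m_{α(1)}) ⋯ f(m_{α(n)})`. -/
def symProd (f : M →ₗ[k] A) (n : ℕ) : MultilinearMap k (fun _ : Fin n => M) A :=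
  (n.factorial : k)⁻¹ • ∑ α : Equiv.Perm (Fin n),
    ((MultilinearMap.mkPiAlgebraFin k n A).compLinearMap fun _ => f).domDomCongr α

theorem symProd_apply (f : M →ₗ[k] A) (n : ℕ) (m : Fin n → M) :
    symProd f n m =
      (n.factorial : k)⁻¹ • ∑ α : Equiv.Perm (Fin n), (List.ofFn fun i => f (m (α i))).prod := by
  simp [symProd]

theorem symProd_perm (f : M →ₗ[k] A) (n : ℕ) (m : Fin n → M) (β : Equiv.Perm (Fin n)) :
    symProd f n (fun i => m (β i)) = symProd f n m := by
  rw [symProd_apply, symProd_apply]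
  congr 1
  exact Fintype.sum_equiv (Equiv.mulLeft β) _ _ fun α => rfl

/-- Symmetrization on the tensor algebra. -/
def tensorSymmetrize (f : M →ₗ[k] A) : TensorAlgebra k M →ₗ[k] A :=
  DirectSum.toModule k ℕ A (fun n => PiTensorProduct.lift (symProd f n)) ∘ₗ
    (TensorAlgebra.toDirectSum (R := k) (M := M)).toLinearMap

theorem tensorSymmetrize_tprod (f : M →ₗ[k] A) (n : ℕ) (m : Fin n → M) :
    tensorSymmetrize f (TensorAlgebra.tprod k M n m) = symProd f n m := by
  simp only [tensorSymmetrize, LinearMap.comp_apply, AlgHom.toLinearMap_apply,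
    TensorAlgebra.toDirectSum_tensorPower_tprod]
  exact (DirectSum.toModule_lof k _ _).trans (PiTensorProduct.lift.tprod _)

theorem tensorSymmetrize_list (f : M →ₗ[k] A) (l l' : List M) (x y : M) :
    tensorSymmetrize f ((l ++ x :: y :: l').map (TensorAlgebra.ι k)).prod =
      tensorSymmetrize f ((l ++ y :: x :: l').map (TensorAlgebra.ι k)).prod := by
  have key (n : ℕ) (m : Fin n → M) (l : List M) (h : l = List.ofFn m) :
      (l.map (TensorAlgebra.ι k)).prod = TensorAlgebra.tprod k M n m := by
    rw [TensorAlgebra.tprod_apply, h, List.map_ofFn]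
    rfl
  have hp : l.length < (l ++ x :: y :: l').length := by simp
  have hp' : l.length + 1 < (l ++ x :: y :: l').length := by simp
  have h2 : l ++ y :: x :: l' = List.ofFn (fun i => (l ++ x :: y :: l').get
      (Equiv.swap (⟨l.length, hp⟩ : Fin (l ++ x :: y :: l').length) ⟨l.length + 1, hp'⟩ i)) := by
    refine List.ext_getElem (by simp; omega) fun j h1 h2 => ?_
    rw [List.getElem_ofFn, Equiv.swap_apply_def]
    simp only [Fin.ext_iff]
    split_ifs with h3 h4
    · subst h3; simp
    · subst h4; simp
    · simp only [List.get_eq_getElem, List.getElem_append, List.getElem_cons]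
      split_ifs <;> first | rfl | omega
  rw [key _ _ _ (List.ofFn_get _).symm, key _ _ _ h2, tensorSymmetrize_tprod,
    tensorSymmetrize_tprod, symProd_perm]

theorem span_list_prod : Submodule.span k (Set.range fun l : List M =>
    (l.map (TensorAlgebra.ι k)).prod) = (⊤ : Submodule k (TensorAlgebra k M)) := by
  refine eq_top_iff.2 fun a _ => ?_
  induction a using TensorAlgebra.induction with
  | algebraMap r =>
    rw [Algebra.algebraMap_eq_smul_one]
    exact Submodule.smul_mem _ _ (Submodule.subset_span ⟨[], by simp⟩)
  | ι x => exact Submodule.subset_span ⟨[x], by simp⟩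
  | mul a b ha hb =>
    have := Submodule.mul_mem_mul (ha trivial) (hb trivial)
    rw [Submodule.span_mul_span] at this
    refine Submodule.span_mono ?_ this
    rintro _ ⟨_, ⟨l, rfl⟩, _, ⟨l', rfl⟩, rfl⟩
    exact ⟨l ++ l', by simp⟩
  | add a b ha hb => exact add_mem (ha trivial) (hb trivial)

theorem tensorSymmetrize_swap (f : M →ₗ[k] A) (x y : M) (u v : TensorAlgebra k M) :
    tensorSymmetrize f (u * (TensorAlgebra.ι k x * TensorAlgebra.ι k y) * v) =
      tensorSymmetrize f (u * (TensorAlgebra.ι k y * TensorAlgebra.ι k x) * v) := by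
  have hu : u ∈ Submodule.span k (Set.range fun l : List M =>
    (l.map (TensorAlgebra.ι k)).prod) := by
    rw [span_list_prod]; exact Submodule.mem_top
  have hv : v ∈ Submodule.span k (Set.range fun l : List M =>
    (l.map (TensorAlgebra.ι k)).prod) := by
    rw [span_list_prod]; exact Submodule.mem_top
  induction hu using Submodule.span_induction with
  | zero => simp
  | add a b _ _ ha hb => simp only [add_mul, map_add, ha, hb]
  | smul r a _ ha => simp only [smul_mul_assoc, map_smul, ha]
  | mem a ha =>
    obtain ⟨l, rfl⟩ := ha
    induction hv using Submodule.span_induction with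
    | zero => simp
    | add a b _ _ ha hb => simp only [mul_add, map_add, ha, hb]
    | smul r a _ ha => simp only [mul_smul_comm, map_smul, ha]
    | mem b hb =>
      obtain ⟨l', rfl⟩ := hb
      simpa [mul_assoc] using tensorSymmetrize_list f l l' x y

theorem tensorSymmetrize_eq_of_algHom_eq (f : M →ₗ[k] A) (a b : TensorAlgebra k M)
    (h : TensorAlgebra.symRingCon k M a b) : tensorSymmetrize f a = tensorSymmetrize f b := by
  let c : RingCon (TensorAlgebra k M) :=
    { r := fun a b => ∀ u v, tensorSymmetrize f (u * a * v) = tensorSymmetrize f (u * b * v)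
      iseqv := ⟨fun _ _ _ => rfl, fun h u v => (h u v).symm, fun h h' u v => (h u v).trans (h' u v)⟩
      add' := fun h h' u v => by simp only [mul_add, add_mul, map_add, h u v, h' u v]
      mul' := fun {a b c d} h h' u v => by
        have h1 := h u (c * v)
        have h2 := h' (u * b) v
        simp only [mul_assoc] at h1 h2 ⊢
        exact h1.trans h2 }
  have hc : TensorAlgebra.symRingCon k M ≤ c := by
    refine RingCon.ringConGen_le.2 fun x y hxy => ?_
    cases hxy with
    | mul_comm x y => exact tensorSymmetrize_swap f x y
  simpa using hc h 1 1

/-- The symmetrization map `Sym(M) → A` of a linear map `f : M → A`: it is the linear map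
`m₁ ⋯ mₙ ↦ (1/n!) ∑_α f(m_{α(1)}) ⋯ f(m_{α(n)})`. -/
def symmetrize (f : M →ₗ[k] A) : SymmetricAlgebra k M →ₗ[k] A where
  toFun a := Quotient.lift (tensorSymmetrize f) (tensorSymmetrize_eq_of_algHom_eq f) a
  map_add' a b := by
    obtain ⟨a, rfl⟩ := SymmetricAlgebra.algHom_surjective k M a
    obtain ⟨b, rfl⟩ := SymmetricAlgebra.algHom_surjective k M b
    exact map_add (tensorSymmetrize f) a b
  map_smul' r a := by
    obtain ⟨a, rfl⟩ := SymmetricAlgebra.algHom_surjective k M a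
    exact map_smul (tensorSymmetrize f) r a

theorem symmetrize_prod (f : M →ₗ[k] A) (n : ℕ) (m : Fin n → M) :
    symmetrize f (∏ i, SymmetricAlgebra.ι k M (m i)) =
      (n.factorial : k)⁻¹ • ∑ α : Equiv.Perm (Fin n), (List.ofFn fun i => f (m (α i))).prod := by
  rw [← symProd_apply, ← tensorSymmetrize_tprod]
  have : ∏ i, SymmetricAlgebra.ι k M (m i) =
      SymmetricAlgebra.algHom k M (TensorAlgebra.tprod k M n m) := by
    rw [TensorAlgebra.tprod_apply, map_list_prod, List.map_ofFn, List.prod_ofFn]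
    rfl
  rw [this]
  rfl

end Symmetrization

section SigmaOne

attribute [local instance 100] LieRing.ofAssociativeRing

variable (k g : Type*) [Field k] [LieRing g] [LieAlgebra k g]

/-- The symmetrization map `Sym(g) → U(g)`. -/
def sigmaOne : SymmetricAlgebra k g →ₗ[k] UniversalEnvelopingAlgebra k g :=
  symmetrize (UniversalEnvelopingAlgebra.ι k : g →ₗ⁅k⁆ UniversalEnvelopingAlgebra k g).toLinearMap

end SigmaOne

section Statement

variable (k g : Type*) [Field k] [LieRing g] [LieAlgebra k g]

/-- `Sym(g ⊗ k²)`. -/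
abbrev SymG : Type _ := SymmetricAlgebra k (g ⊗[k] (Fin 2 → k))

/-- The linear action of `GL₂(ℤ)` on `Sym(g ⊗ k²)` induced by the standard action on `k²`. -/
def rhoS : Representation k (GL (Fin 2) ℤ) (SymG k g) where
  toFun P := (symMap (LinearMap.lTensor g
    (Matrix.toLin' (P.val.map (Int.cast : ℤ → k))))).toLinearMap
  map_one' := by
    have h : symMap (LinearMap.lTensor g (Matrix.toLin' ((1 : Matrix (Fin 2) (Fin 2) ℤ).map
        (Int.cast : ℤ → k)))) = .id k (SymG k g) := by
      refine SymmetricAlgebra.algHom_ext (A := SymG k g) ?_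
      ext X v
      simp
    exact congrArg AlgHom.toLinearMap h
  map_mul' P Q := by
    have h (P Q : Matrix (Fin 2) (Fin 2) ℤ) :
        symMap (LinearMap.lTensor g (Matrix.toLin' ((P * Q).map (Int.cast : ℤ → k)))) =
          (symMap (LinearMap.lTensor g (Matrix.toLin' (P.map (Int.cast : ℤ → k))))).comp
            (symMap (LinearMap.lTensor g (Matrix.toLin' (Q.map (Int.cast : ℤ → k))))) := by
      refine SymmetricAlgebra.algHom_ext (A := SymG k g) ?_
      ext X v
      simp [Matrix.map_mul_intCast]
    exact congrArg AlgHom.toLinearMap (h P.val Q.val)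

/-- The adjoint action of `X ∈ g` on `Sym(g ⊗ k²)`. -/
def adSym (X : g) : Derivation k (SymG k g) (SymG k g) :=
  symDer (LinearMap.rTensor (Fin 2 → k) (LieAlgebra.ad k g X : g →ₗ[k] g))

/-- The image of the adjoint action. -/
def adSpan : Submodule k (SymG k g) :=
  Submodule.span k {y | ∃ (X : g) (f : SymG k g), y = adSym k g X f}

/-- The quotient of `Sym(g ⊗ k²)` by the image of the adjoint action. -/
abbrev SymBar : Type _ := SymG k g ⧸ adSpan k g

theorem rhoS_adSpan (P : GL (Fin 2) ℤ) : adSpan k g ≤ (adSpan k g).comap (rhoS k g P) := by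
  refine Submodule.span_le.2 ?_
  rintro _ ⟨X, f, rfl⟩
  refine Submodule.subset_span ⟨X, rhoS k g P f, ?_⟩
  refine (symDer_symMap _ _ _ ?_ f).symm
  ext x i
  simp

/-- The induced action of `GL₂(ℤ)` on the quotient. -/
def rhoSBar : Representation k (GL (Fin 2) ℤ) (SymBar k g) where
  toFun P := (adSpan k g).mapQ (adSpan k g) (rhoS k g P) (rhoS_adSpan k g P)
  map_one' := by
    refine Submodule.linearMap_qext _ (LinearMap.ext fun t => ?_)
    simp
  map_mul' P Q := by
    refine Submodule.linearMap_qext _ (LinearMap.ext fun t => ?_)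
    simp

/-- The algebra map `Sym(g ⊗ k²) → Sym(g) ⊗ Sym(g)`,
`X ⊗ v ↦ v₀ (X ⊗ 1) + v₁ (1 ⊗ X)` (an isomorphism). -/
def symSplit : SymG k g →ₐ[k] SymmetricAlgebra k g ⊗[k] SymmetricAlgebra k g :=
  SymmetricAlgebra.lift (TensorProduct.lift (LinearMap.mk₂ k
    (fun X v => v 0 • (SymmetricAlgebra.ι k g X ⊗ₜ[k] (1 : SymmetricAlgebra k g)) +
      v 1 • ((1 : SymmetricAlgebra k g) ⊗ₜ[k] SymmetricAlgebra.ι k g X))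
    (fun X Y v => by
      simp only [map_add, TensorProduct.add_tmul, TensorProduct.tmul_add, smul_add]; abel)
    (fun r X v => by
      simp only [map_smul, TensorProduct.tmul_smul, ← TensorProduct.smul_tmul', smul_add,
        smul_comm r])
    (fun X v w => by simp only [Pi.add_apply, add_smul]; abel)
    (fun r X v => by simp only [Pi.smul_apply, smul_add, smul_assoc])))

/-- The map `σ : Sym(g ⊗ k²) ≅ Sym(g) ⊗ Sym(g) → U(g) ⊗ U(g)`. -/
def sigma : SymG k g →ₗ[k] UniversalEnvelopingAlgebra k g ⊗[k] UniversalEnvelopingAlgebra k g :=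
  TensorProduct.map (sigmaOne k g) (sigmaOne k g) ∘ₗ (symSplit k g).toLinearMap

end Statement
end HopfOut

end

/-! Brackets in `g` are central, so every computation takes place in a Heisenberg group, and the
only discrepancies are multiples of one central commutator, which the coinvariants kill.

Bijectivity of σ. View `g ⊗ k²` as the class-two Lie algebra `g × g`, with `k²` multiplied
componentwise. Symmetrization sends `mⁿ` to `mⁿ`, and powers span the symmetric algebra in
characteristic zero, so linear identities need only be tested on powers. The
Baker-Campbell-Hausdorff product stops after one term: `m ⋆ f = m f + ½[m, f]` makes `Sym(g ⊗ k²)` a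
module over `U(g) ⊗ U(g)`, and `a ↦ a ⋆ 1` is inverse to σ (`starOp_mul_sub`, `symmetrize_starOp`,
`symmetrize_bijective`). This proves Poincaré-Birkhoff-Witt in the case needed. Moreover σ turns the
derivation `ad X` into the commutator with `ΔX = X ⊗ 1 + 1 ⊗ X`, and these commutators span the
conjugation relations (`sigma_adSym`, `conjSpan_eq_span`). Hence σ descends to an isomorphism of
coinvariants.

Equivariance. It suffices to test on `xᵐ ⊗ yⁿ`, whose generating function is `exp(sx) ⊗ exp(ty)`. A
word with exponents `(a, b)` takes the value `exp(c st z) exp(a s x) exp(b t y)` there, with `z =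
[x, y]` and some scalar `c`. A pair of words therefore gives `exp(st ζ) exp(s p) exp(t q)`, where `p
= x ⊗ v`, `q = y ⊗ w`, `v` and `w` are the columns of the exponent matrix, and `ζ = z ⊗ (c, c')`.
Because `v, w` is a basis of `k²`, commutators with `Δx` and `Δy` produce every `ζˡ⁺¹ pⁱ qʲ`
(`pow_mul_mem_conjSpan`), so only `pᵐ qⁿ` survives. The linear action followed by σ gives the
symmetrization of `pᵐ qⁿ`, which equals the product `pᵐ qⁿ` up to terms of the same kind
(`symmetrize_pow_mul_pow_sub_mem`).

Surjectivity of `outToGL` comes from lifting generators of `GL₂(ℤ)` to automorphisms of `F₂`. -/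

noncomputable section

open scoped TensorProduct

namespace HopfOut

/-! ### Polarization: coefficients of polynomial identities over an infinite field -/

section Polarization

/-- The coefficients of a polynomial map over an infinite field lie in every subspace that contains
its values. -/
theorem mem_of_forall_sum_pow_smul_mem {k V : Type*} [Field k] [Infinite k] [AddCommGroup V]
    [Module k V] (W : Submodule k V) (v : ℕ → V) (N : ℕ)
    (h : ∀ t : k, ∑ i ∈ Finset.range N, t ^ i • v i ∈ W) {i : ℕ} (hi : i < N) : v i ∈ W := by
  -- Functionals separate the points of `V ⧸ W`, and each one turns the hypothesis into a scalar
  -- polynomial vanishing at all points of an infinite field.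
  rw [← Submodule.Quotient.mk_eq_zero W, ← Module.forall_dual_apply_eq_zero_iff k]
  intro φ
  have h0 : ∑ j ∈ Finset.range N, Polynomial.monomial j (φ (Submodule.Quotient.mk (v j))) = 0 := by
    refine Polynomial.funext fun t => ?_
    have h1 : φ (Submodule.Quotient.mk (p := W) (∑ j ∈ Finset.range N, t ^ j • v j)) = 0 := by
      rw [(Submodule.Quotient.mk_eq_zero W).2 (h t), map_zero]
    rw [← Submodule.mkQ_apply] at h1
    simpa [Polynomial.eval_finsetSum, mul_comm] using h1
  have h2 := congrArg (fun p => Polynomial.coeff p i) h0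
  simpa [Polynomial.finsetSum_coeff, Polynomial.coeff_monomial, hi] using h2

variable {k A B : Type*} [Field k] [Ring A] [Algebra k A] [Ring B] [Algebra k B]

/-- Evaluation at a scalar of a polynomial with coefficients in a noncommutative algebra. -/
def evalScalar (A : Type*) [Ring A] [Algebra k A] (t : k) : Polynomial A →+* A :=
  -- Evaluation is multiplicative over a noncommutative ring because the point, a scalar, commutes
  -- with all coefficients.
  Polynomial.eval₂RingHom' (RingHom.id A) (algebraMap k A t)
    fun a => (Algebra.commutes t a).symm

theorem evalScalar_eq_sum (t : k) (P : Polynomial A) (N : ℕ) (hN : P.natDegree < N) :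
    evalScalar A t P = ∑ i ∈ Finset.range N, t ^ i • P.coeff i := by
  change P.eval₂ (RingHom.id A) (algebraMap k A t) = _
  rw [Polynomial.eval₂_eq_sum_range' _ hN]
  refine Finset.sum_congr rfl fun i _ => ?_
  rw [RingHom.id_apply, ← map_pow, ← Algebra.commutes, Algebra.smul_def]

theorem evalScalar_linear (t : k) (x y : A) :
    evalScalar A t (Polynomial.C y + Polynomial.X * Polynomial.C x) = y + t • x := by
  simp [evalScalar, Polynomial.eval₂RingHom', Algebra.smul_def, Polynomial.X_mul_C,
    Algebra.commutes]

/-- This transports an identity between `n`-th powers of `y + t x`, valid for every scalar `t`, to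
an identity between their first-order terms, even though `φ` is only linear. -/
theorem map_coeff_eq_of_evalScalar [CharZero k] (φ : A →ₗ[k] B) (P : Polynomial A)
    (Q : Polynomial B) (h : ∀ t : k, φ (evalScalar A t P) = evalScalar B t Q) (i : ℕ) :
    φ (P.coeff i) = Q.coeff i := by
  have key := mem_of_forall_sum_pow_smul_mem (k := k) (⊥ : Submodule k B)
    (fun i => φ (P.coeff i) - Q.coeff i) (max (max P.natDegree Q.natDegree) i + 1) (fun t => by
      have := h t
      rw [evalScalar_eq_sum t P (max (max P.natDegree Q.natDegree) i + 1) (by omega),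
        evalScalar_eq_sum t Q (max (max P.natDegree Q.natDegree) i + 1) (by omega)] at this
      simp only [smul_sub, Finset.sum_sub_distrib, Submodule.mem_bot]
      rw [← this]
      simp) (i := i) (by omega)
  exact sub_eq_zero.1 key

theorem coeff_mem_of_evalScalar [CharZero k] (W : Submodule k A) (P : Polynomial A)
    (h : ∀ t : k, evalScalar A t P ∈ W) (i : ℕ) : P.coeff i ∈ W := by
  refine mem_of_forall_sum_pow_smul_mem (k := k) W P.coeff (max P.natDegree i + 1) (fun t => ?_)
    (i := i) (by omega)
  rw [← evalScalar_eq_sum t P _ (by omega)]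
  exact h t

/-- The first order term of `(y + t x)ⁿ⁺¹` if `[x, y] = w` commutes with `y`. -/
theorem coeff_one_linear_pow [CharZero k] (x y w : A) (hw : x * y - y * x = w) (hwy : Commute w y)
    (n : ℕ) :
    ((Polynomial.C y + Polynomial.X * Polynomial.C x) ^ (n + 1)).coeff 1 =
      ((n : k) + 1) • (x * y ^ n - ((n : k) / 2) • (w * y ^ (n - 1))) := by
  induction n with
  | zero => simp
  | succ n ih =>
    have h0 (m : ℕ) :
        ((Polynomial.C y + Polynomial.X * Polynomial.C x) ^ m).coeff 0 = y ^ m := by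
      induction m with
      | zero => simp
      | succ m ih => rw [pow_succ, Polynomial.mul_coeff_zero, ih, pow_succ]; simp
    have hyx : y * x = x * y - w := by rw [← hw]; abel
    -- The factor `n` makes the truncated exponent `n - 1` harmless at `n = 0`.
    have h1 : y * (w * y ^ (n - 1)) * ((n : k) • 1) = (n : k) • (w * y ^ n) := by
      cases n with
      | zero => simp
      | succ n =>
        rw [mul_smul_comm, mul_one, Nat.add_sub_cancel, ← mul_assoc, ← hwy.eq, mul_assoc, pow_succ']
    have h2 : y * (x * y ^ n) = x * y ^ (n + 1) - w * y ^ n := by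
      rw [← mul_assoc, hyx, sub_mul, mul_assoc, pow_succ']
    rw [mul_smul_comm, mul_one] at h1
    rw [pow_succ', Polynomial.mul_coeff_one, ih, h0]
    simp only [Polynomial.coeff_add, Polynomial.coeff_C_zero, Polynomial.coeff_X_mul,
      Polynomial.coeff_C_succ, Polynomial.mul_coeff_zero, Polynomial.coeff_X_zero, zero_mul,
      add_zero, zero_add, mul_smul_comm, mul_sub, h2, Nat.add_sub_cancel]
    have h3 : (n : k) • (y * (w * y ^ (n - 1))) = (n : k) • (w * y ^ n) := h1
    rw [div_eq_inv_mul, mul_smul, h3]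
    push_cast
    module

end Polarization

/-! ### Powers of linear forms span the symmetric algebra -/

section PowerSpan

variable {k M : Type*} [Field k] [CharZero k] [AddCommGroup M] [Module k M]

/-- In characteristic zero the symmetric algebra is spanned by powers of elements of degree one. -/
theorem span_ι_pow : Submodule.span k {a : SymmetricAlgebra k M |
    ∃ (m : M) (n : ℕ), a = SymmetricAlgebra.ι k M m ^ n} = ⊤ := by
  set P := Submodule.span k {a : SymmetricAlgebra k M |
    ∃ (m : M) (n : ℕ), a = SymmetricAlgebra.ι k M m ^ n} with hP
  have hmul (m : M) (f : SymmetricAlgebra k M) (hf : f ∈ P) :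
      SymmetricAlgebra.ι k M m * f ∈ P := by
    induction hf using Submodule.span_induction with
    | zero => simp
    | add a b _ _ ha hb => rw [mul_add]; exact add_mem ha hb
    | smul r a _ ha => rw [mul_smul_comm]; exact P.smul_mem r ha
    | mem a ha =>
      obtain ⟨y, n, rfl⟩ := ha
      -- `(n + 1) m yⁿ` is the linear coefficient in `t` of `(y + t m)ⁿ⁺¹`, all of whose values are
      -- powers; characteristic zero allows division by `n + 1`.
      have h1 := coeff_mem_of_evalScalar P ((Polynomial.C (SymmetricAlgebra.ι k M y) +
        Polynomial.X * Polynomial.C (SymmetricAlgebra.ι k M m)) ^ (n + 1)) (fun t => by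
          rw [map_pow, evalScalar_linear, ← map_smul, ← map_add]
          exact Submodule.subset_span ⟨_, _, rfl⟩) 1
      rw [coeff_one_linear_pow (k := k) (A := SymmetricAlgebra k M) _ _ 0
        (by rw [mul_comm, sub_self]) (Commute.zero_left _)] at h1
      have h2 := P.smul_mem ((n : k) + 1)⁻¹ h1
      rw [smul_smul, inv_mul_cancel₀ (Nat.cast_add_one_ne_zero n), one_smul] at h2
      simpa using h2
  have hall (a f : SymmetricAlgebra k M) (hf : f ∈ P) : a * f ∈ P := by
    induction a using SymmetricAlgebra.induction generalizing f with
    | algebraMap r => rw [← Algebra.smul_def]; exact P.smul_mem r hf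
    | ι x => exact hmul x f hf
    | mul a b ha hb => rw [mul_assoc]; exact ha _ (hb _ hf)
    | add a b ha hb => rw [add_mul]; exact add_mem (ha _ hf) (hb _ hf)
  refine eq_top_iff.2 fun a _ => ?_
  simpa using hall a 1 (Submodule.subset_span ⟨0, 0, by simp⟩)

theorem linearMap_ext_ι_pow {N : Type*} [AddCommGroup N] [Module k N]
    {φ ψ : SymmetricAlgebra k M →ₗ[k] N}
    (h : ∀ (m : M) (n : ℕ), φ (SymmetricAlgebra.ι k M m ^ n) = ψ (SymmetricAlgebra.ι k M m ^ n)) :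
    φ = ψ := by
  refine LinearMap.ext_on span_ι_pow ?_
  rintro _ ⟨m, n, rfl⟩
  exact h m n

theorem symmetrize_ι_pow {A : Type*} [Ring A] [Algebra k A] (f : M →ₗ[k] A) (m : M) (n : ℕ) :
    symmetrize f (SymmetricAlgebra.ι k M m ^ n) = f m ^ n := by
  have h := symmetrize_prod f n (fun _ => m)
  simp only [Finset.prod_const, Finset.card_univ, Fintype.card_fin, List.ofFn_const,
    List.prod_replicate, Finset.sum_const, Fintype.card_perm] at h
  rw [h, ← Nat.cast_smul_eq_nsmul k, smul_smul,
    inv_mul_cancel₀ (Nat.cast_ne_zero.2 n.factorial_ne_zero), one_smul]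

end PowerSpan

/-! ### The star product and Poincaré-Birkhoff-Witt in class two -/

section PBW

variable {k M A : Type*} [Field k] [AddCommGroup M] [Module k M] [Ring A]
  [Algebra k A] (br : M →ₗ[k] M →ₗ[k] M) (j : M →ₗ[k] A)

/-- The operator `f ↦ m f + ½ [m, f]` of left multiplication by `m` in the star product. -/
def starOp (m : M) : Module.End k (SymmetricAlgebra k M) :=
  LinearMap.mulLeft k (SymmetricAlgebra.ι k M m) +
    (2⁻¹ : k) • (symDer (br m) : SymmetricAlgebra k M →ₗ[k] SymmetricAlgebra k M)

theorem starOp_apply (m : M) (f : SymmetricAlgebra k M) :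
    starOp br m f = SymmetricAlgebra.ι k M m * f + (2⁻¹ : k) • symDer (br m) f := rfl

theorem symDer_zero : symDer (0 : M →ₗ[k] M) = 0 := by
  refine Derivation.ext fun f => ?_
  induction f using SymmetricAlgebra.induction with
  | algebraMap r => simp
  | ι x => simp
  | mul a b ha hb => simp_all
  | add a b ha hb => simp_all

theorem symDer_ι_pow (φ : M →ₗ[k] M) (m : M) (n : ℕ) :
    symDer φ (SymmetricAlgebra.ι k M m ^ n) = (n : k) •
      (SymmetricAlgebra.ι k M (φ m) * SymmetricAlgebra.ι k M m ^ (n - 1)) := by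
  rw [Derivation.leibniz_pow, symDer_ι, Nat.cast_smul_eq_nsmul, smul_eq_mul, mul_comm]

variable (h2 : ∀ a b c, br (br a b) c = 0) (h1 : ∀ a, br a a = 0)

include h1 in
theorem br_antisymm (a b : M) : br a b = -br b a := by
  have := h1 (a + b)
  rw [map_add, map_add, LinearMap.add_apply, LinearMap.add_apply, h1, h1, zero_add, add_zero] at this
  rw [eq_neg_iff_add_eq_zero, add_comm]
  exact this

include h1 h2 in
theorem br_br (a b c : M) : br a (br b c) = 0 := by
  rw [br_antisymm br h1, h2, neg_zero]

include h1 h2 in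
-- On generators both composites are double brackets, hence zero; in the Leibniz expansion the cross
-- terms are symmetric in `a` and `b`.
theorem symDer_br_comm (a b : M) (f : SymmetricAlgebra k M) :
    symDer (br a) (symDer (br b) f) = symDer (br b) (symDer (br a) f) := by
  induction f using SymmetricAlgebra.induction with
  | algebraMap r => simp
  | ι x => simp [br_br br h2 h1]
  | mul x y hx hy => simp only [Derivation.leibniz, map_add, smul_eq_mul, hx, hy]; ring
  | add x y hx hy => simp only [map_add, hx, hy]

include h2 in
theorem starOp_br (a b : M) (f : SymmetricAlgebra k M) :
    starOp br (br a b) f = SymmetricAlgebra.ι k M (br a b) * f := by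
  have : br (br a b) = 0 := LinearMap.ext (h2 a b)
  rw [starOp_apply, this, symDer_zero, Derivation.zero_apply, smul_zero, add_zero]

include h1 in
theorem starOp_ι_pow (m : M) (n : ℕ) :
    starOp br m (SymmetricAlgebra.ι k M m ^ n) = SymmetricAlgebra.ι k M m ^ (n + 1) := by
  rw [starOp_apply, symDer_ι_pow, h1, map_zero, zero_mul, smul_zero, smul_zero, add_zero, pow_succ']

variable (hj : ∀ a b, j a * j b - j b * j a = j (br a b))

include hj h2 in
theorem commute_j_br (a b c : M) : Commute (j (br a b)) (j c) := by
  have := hj (br a b) c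
  rw [h2, map_zero, sub_eq_zero] at this
  exact this

variable [CharZero k]

include h1 h2 in
-- With `D_a = symDer (br a)`, the two mixed commutators each contribute `½[a, b]`, while `[D_a,
-- D_b] = 0`. The derivation part of the right side also vanishes, because `[a, b]` is central.
theorem starOp_mul_sub (a b : M) :
    starOp br a * starOp br b - starOp br b * starOp br a = starOp br (br a b) := by
  refine LinearMap.ext fun f => ?_
  rw [LinearMap.sub_apply, Module.End.mul_apply, Module.End.mul_apply, starOp_br br h2]
  simp only [starOp_apply, map_add, map_smul, Derivation.leibniz, symDer_ι, smul_eq_mul,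
    symDer_br_comm br h2 h1 a b]
  rw [br_antisymm br h1 b a, map_neg, mul_left_comm (SymmetricAlgebra.ι k M a)]
  simp only [smul_add, mul_neg, smul_neg]
  rw [mul_comm f]
  module

include hj h2 in
-- Apply symmetrization to `(y + t m)ⁿ⁺¹` and compare linear terms in `t`. In the symmetric algebra
-- this term is `(n + 1) m yⁿ`; in `A`, moving `j m` to the front of each summand produces the
-- central correction.
theorem symmetrize_ι_mul_pow (m y : M) (n : ℕ) :
    symmetrize j (SymmetricAlgebra.ι k M m * SymmetricAlgebra.ι k M y ^ n) =
      j m * j y ^ n - ((n : k) / 2) • (j (br m y) * j y ^ (n - 1)) := by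
  have h := map_coeff_eq_of_evalScalar (symmetrize j)
    ((Polynomial.C (SymmetricAlgebra.ι k M y) +
        Polynomial.X * Polynomial.C (SymmetricAlgebra.ι k M m)) ^ (n + 1))
    ((Polynomial.C (j y) + Polynomial.X * Polynomial.C (j m)) ^ (n + 1)) (fun t => by
      rw [map_pow, evalScalar_linear, ← map_smul, ← map_add, symmetrize_ι_pow, map_pow,
        evalScalar_linear, ← map_smul, ← map_add]) 1
  rw [coeff_one_linear_pow (k := k) (A := SymmetricAlgebra k M) _ _ 0
      (by rw [mul_comm, sub_self]) (Commute.zero_left _),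
    coeff_one_linear_pow (k := k) _ _ _ (hj m y) (commute_j_br br j h2 hj m y y), map_smul,
    zero_mul, smul_zero, sub_zero] at h
  exact smul_right_injective _ (Nat.cast_add_one_ne_zero n) h

include hj h2 in
theorem symmetrize_br_mul_pow (a b y : M) (n : ℕ) :
    symmetrize j (SymmetricAlgebra.ι k M (br a b) * SymmetricAlgebra.ι k M y ^ n) =
      j (br a b) * j y ^ n := by
  rw [symmetrize_ι_mul_pow br j h2 hj, h2]
  simp

include hj h2 in
/-- Symmetrization turns the derivation `[m, ·]` into the commutator with `m`. -/
theorem symmetrize_symDer (m : M) (f : SymmetricAlgebra k M) :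
    symmetrize j (symDer (br m) f) = j m * symmetrize j f - symmetrize j f * j m := by
  suffices h : symmetrize j ∘ₗ (symDer (br m) : SymmetricAlgebra k M →ₗ[k] SymmetricAlgebra k M) =
      (LinearMap.mulLeft k (j m) - LinearMap.mulRight k (j m)) ∘ₗ symmetrize j from
    LinearMap.congr_fun h f
  refine linearMap_ext_ι_pow fun y n => ?_
  simp only [LinearMap.comp_apply, Derivation.coeFn_coe, LinearMap.sub_apply,
    LinearMap.mulLeft_apply, LinearMap.mulRight_apply]
  rw [symDer_ι_pow, map_smul, symmetrize_br_mul_pow br j h2 hj, symmetrize_ι_pow]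
  induction n with
  | zero => simp
  | succ n ih =>
    -- Leibniz rule for the inner derivation by `j m`; since `[m, y]` is central, each factor `j y`
    -- contributes the same term.
    have e : j m * j y ^ (n + 1) - j y ^ (n + 1) * j m =
        (j m * j y ^ n - j y ^ n * j m) * j y + j y ^ n * (j m * j y - j y * j m) := by
      rw [pow_succ]; noncomm_ring
    have hc := (commute_j_br br j h2 hj m y y).pow_right n
    rw [e, ← ih, hj, ← hc.eq, smul_mul_assoc]
    cases n with
    | zero => simp
    | succ n =>
      simp only [Nat.add_sub_cancel, mul_assoc, ← pow_succ]
      push_cast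
      module

include hj h2 in
/-- Symmetrization turns the star product into the product. -/
theorem symmetrize_starOp (m : M) (f : SymmetricAlgebra k M) :
    symmetrize j (starOp br m f) = j m * symmetrize j f := by
  suffices h : symmetrize j ∘ₗ starOp br m = LinearMap.mulLeft k (j m) ∘ₗ symmetrize j from
    LinearMap.congr_fun h f
  refine linearMap_ext_ι_pow fun y n => ?_
  simp only [LinearMap.comp_apply, LinearMap.mulLeft_apply]
  -- The term `½[m, yⁿ] = (n/2)[m, y] yⁿ⁻¹` of the star product cancels exactly the correction from
  -- symmetrizing `m yⁿ`.
  rw [starOp_apply, symDer_ι_pow, map_add, map_smul, map_smul, symmetrize_ι_mul_pow br j h2 hj,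
    symmetrize_br_mul_pow br j h2 hj, symmetrize_ι_pow]
  module

include hj h2 h1 in
/-- The Poincaré-Birkhoff-Witt theorem for brackets of class two: if `A` is generated by `M` and
acts on `Sym(M)` by the star product, then symmetrization is bijective. -/
theorem symmetrize_bijective (T : A →ₐ[k] Module.End k (SymmetricAlgebra k M))
    (hT : ∀ m, T (j m) = starOp br m) (hA : Algebra.adjoin k (Set.range j) = ⊤) :
    Function.Bijective (symmetrize j) := by
  constructor
  -- Acting on `1` inverts symmetrization: `m ⋆ mⁿ = mⁿ⁺¹` because `[m, m] = 0`, so `(j m)ⁿ` sends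
  -- `1` to `mⁿ`.
  · refine Function.LeftInverse.injective (g := fun a => T a 1) fun f => ?_
    suffices h : LinearMap.applyₗ 1 ∘ₗ T.toLinearMap ∘ₗ symmetrize j = LinearMap.id from
      LinearMap.congr_fun h f
    refine linearMap_ext_ι_pow fun m n => ?_
    simp only [LinearMap.comp_apply, symmetrize_ι_pow, AlgHom.toLinearMap_apply, map_pow, hT,
      LinearMap.applyₗ_apply_apply, LinearMap.id_apply]
    induction n with
    | zero => simp
    | succ n ih => rw [pow_succ', Module.End.mul_apply, ih, starOp_ι_pow br h1]
  · intro a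
    -- Symmetrization is `A`-linear for the star action, since it is so for the generators `j m`.
    -- Taking `f = 1` exhibits `a` as a value.
    have key : ∀ f, symmetrize j (T a f) = a * symmetrize j f := by
      have ha : a ∈ Algebra.adjoin k (Set.range j) := by rw [hA]; trivial
      induction ha using Algebra.adjoin_induction with
      | mem x hx =>
        obtain ⟨m, rfl⟩ := hx
        intro f
        rw [hT, symmetrize_starOp br j h2 hj]
      | algebraMap r =>
        intro f
        rw [AlgHom.commutes, Module.algebraMap_end_apply, map_smul, Algebra.smul_def]
      | add x y _ _ hx hy => intro f; rw [map_add, LinearMap.add_apply, map_add, hx, hy, add_mul]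
      | mul x y _ _ hx hy => intro f; rw [map_mul, Module.End.mul_apply, hx, hy, mul_assoc]
    refine ⟨T a 1, ?_⟩
    have h0 := symmetrize_ι_pow j 0 0
    rw [pow_zero, pow_zero] at h0
    rw [key, h0, mul_one]

end PBW

/-! ### Linearity of the star action in the acting element -/

section SymDerLinear

variable {k M : Type*} [Field k] [AddCommGroup M] [Module k M]

theorem symDer_add (φ ψ : M →ₗ[k] M) : symDer (φ + ψ) = symDer φ + symDer ψ := by
  refine Derivation.ext fun f => ?_
  induction f using SymmetricAlgebra.induction with
  | algebraMap r => simp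
  | ι x => simp
  | mul a b ha hb =>
    simp only [Derivation.leibniz, Derivation.add_apply, smul_eq_mul] at ha hb ⊢
    simp only [ha, hb, mul_add]
  | add a b ha hb => simp only [map_add, ha, hb]

theorem symDer_smul (r : k) (φ : M →ₗ[k] M) : symDer (r • φ) = r • symDer φ := by
  refine Derivation.ext fun f => ?_
  induction f using SymmetricAlgebra.induction with
  | algebraMap r => simp
  | ι x => simp
  | mul a b ha hb =>
    simp only [Derivation.leibniz, Derivation.smul_apply, smul_eq_mul] at ha hb ⊢
    simp only [ha, hb, mul_smul_comm]
  | add a b ha hb => simp_all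

theorem starOp_add (br : M →ₗ[k] M →ₗ[k] M) (a b : M) :
    starOp br (a + b) = starOp br a + starOp br b := by
  refine LinearMap.ext fun f => ?_
  simp only [starOp_apply, LinearMap.add_apply, map_add, symDer_add, Derivation.add_apply, add_mul,
    smul_add]
  abel

theorem starOp_smul (br : M →ₗ[k] M →ₗ[k] M) (r : k) (a : M) :
    starOp br (r • a) = r • starOp br a := by
  refine LinearMap.ext fun f => ?_
  simp only [starOp_apply, LinearMap.smul_apply, map_smul, symDer_smul, Derivation.smul_apply,
    smul_mul_assoc, smul_add, smul_comm r]

end SymDerLinear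

/-! ### The Lie algebra `g × g`, realized as `g ⊗ k²` -/

section Double

attribute [local instance 100] LieRing.ofAssociativeRing

open UniversalEnvelopingAlgebra

variable (k g : Type*) [Field k] [LieRing g] [LieAlgebra k g]

/-- The linear map `X ⊗ v ↦ v₀ (X ⊗ 1) + v₁ (1 ⊗ X)`. -/
def jMap : g ⊗[k] (Fin 2 → k) →ₗ[k]
    UniversalEnvelopingAlgebra k g ⊗[k] UniversalEnvelopingAlgebra k g :=
  TensorProduct.lift (LinearMap.mk₂ k
    (fun X v => v 0 • (ι k X ⊗ₜ[k] (1 : UniversalEnvelopingAlgebra k g)) +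
      v 1 • ((1 : UniversalEnvelopingAlgebra k g) ⊗ₜ[k] ι k X))
    (fun X Y v => by
      simp only [map_add, TensorProduct.add_tmul, TensorProduct.tmul_add, smul_add]; abel)
    (fun r X v => by
      simp only [map_smul, TensorProduct.tmul_smul, ← TensorProduct.smul_tmul', smul_add,
        smul_comm r])
    (fun X v w => by simp only [Pi.add_apply, add_smul]; abel)
    (fun r X v => by simp only [Pi.smul_apply, smul_add, smul_assoc]))

/-- The bracket `[X ⊗ v, Y ⊗ w] = [X, Y] ⊗ v w` of the Lie algebra `g × g`. -/
def brMap : g ⊗[k] (Fin 2 → k) →ₗ[k] g ⊗[k] (Fin 2 → k) →ₗ[k] g ⊗[k] (Fin 2 → k) :=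
  TensorProduct.map₂ (LieModule.toEnd k g g : g →ₗ[k] Module.End k g) (LinearMap.mul k (Fin 2 → k))

variable {k g}

theorem jMap_tmul (X : g) (v : Fin 2 → k) :
    jMap k g (X ⊗ₜ v) = v 0 • (ι k X ⊗ₜ[k] 1) + v 1 • (1 ⊗ₜ[k] ι k X) := rfl

theorem brMap_tmul (X Y : g) (v w : Fin 2 → k) :
    brMap k g (X ⊗ₜ v) (Y ⊗ₜ w) = ⁅X, Y⁆ ⊗ₜ (v * w) := rfl

theorem exists_eq_tmul_add_tmul (m : g ⊗[k] (Fin 2 → k)) :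
    ∃ X Y : g, m = X ⊗ₜ Pi.single 0 1 + Y ⊗ₜ Pi.single 1 1 := by
  induction m with
  | zero => exact ⟨0, 0, by simp⟩
  | tmul X v =>
    refine ⟨v 0 • X, v 1 • X, ?_⟩
    rw [TensorProduct.smul_tmul, TensorProduct.smul_tmul, ← TensorProduct.tmul_add]
    congr 1
    ext i
    fin_cases i <;> simp
  | add a b ha hb =>
    obtain ⟨X, Y, rfl⟩ := ha
    obtain ⟨X', Y', rfl⟩ := hb
    exact ⟨X + X', Y + Y', by simp only [TensorProduct.add_tmul]; abel⟩

/-- The lower central series is indexed from `0`, starting at `g` itself, so its term `2` is `[g,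
[g, g]]`. -/
theorem lie_lie_eq_zero (hg : LieModule.lowerCentralSeries k g g 2 = ⊥) (X Y Z : g) :
    ⁅X, ⁅Y, Z⁆⁆ = 0 := by
  have h : ⁅X, ⁅Y, Z⁆⁆ ∈ LieModule.lowerCentralSeries k g g 2 := by
    rw [LieModule.lowerCentralSeries_succ, LieModule.lowerCentralSeries_succ]
    exact LieSubmodule.lie_mem_lie (LieSubmodule.mem_top X)
      (LieSubmodule.lie_mem_lie (LieSubmodule.mem_top Y) (LieSubmodule.mem_top Z))
  rw [hg] at h
  exact h

theorem ι_mul_sub (X Y : g) : ι k X * ι k Y - ι k Y * ι k X = ι k ⁅X, Y⁆ := by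
  rw [LieHom.map_lie, LieRing.of_associative_ring_bracket]

theorem brMap_brMap (hg : LieModule.lowerCentralSeries k g g 2 = ⊥)
    (a b c : g ⊗[k] (Fin 2 → k)) : brMap k g (brMap k g a b) c = 0 := by
  have h (X Y Z : g) : ⁅⁅X, Y⁆, Z⁆ = 0 := by
    rw [← lie_skew, lie_lie_eq_zero hg, neg_zero]
  induction a with
  | zero => simp
  | add a a' ha ha' => simp only [map_add, LinearMap.add_apply, ha, ha', add_zero]
  | tmul X v =>
    induction b with
    | zero => simp
    | add a a' ha ha' => simp only [map_add, LinearMap.add_apply, ha, ha', add_zero]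
    | tmul Y w =>
      induction c with
      | zero => simp
      | add a a' ha ha' => simp only [map_add, ha, ha', add_zero]
      | tmul Z u => rw [brMap_tmul, brMap_tmul, h, TensorProduct.zero_tmul]

theorem brMap_self (a : g ⊗[k] (Fin 2 → k)) : brMap k g a a = 0 := by
  obtain ⟨X, Y, rfl⟩ := exists_eq_tmul_add_tmul a
  have h : (Pi.single 0 1 * Pi.single 1 1 : Fin 2 → k) = 0 := by
    ext i; fin_cases i <;> simp
  simp only [map_add, LinearMap.add_apply, brMap_tmul, lie_self, TensorProduct.zero_tmul, h,
    mul_comm (Pi.single 1 1 : Fin 2 → k), TensorProduct.tmul_zero, add_zero]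

theorem jMap_mul_sub (a b : g ⊗[k] (Fin 2 → k)) :
    jMap k g a * jMap k g b - jMap k g b * jMap k g a = jMap k g (brMap k g a b) := by
  induction a with
  | zero => simp
  | add a a' ha ha' =>
    simp only [map_add, LinearMap.add_apply, ← ha, ← ha']; noncomm_ring
  | tmul X v =>
    induction b with
    | zero => simp
    | add a a' ha ha' => simp only [map_add, ← ha, ← ha']; noncomm_ring
    | tmul Y w =>
      rw [brMap_tmul, jMap_tmul, jMap_tmul, jMap_tmul, ← ι_mul_sub]
      simp only [add_mul, mul_add, smul_mul_smul_comm, Algebra.TensorProduct.tmul_mul_tmul, one_mul,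
        mul_one, TensorProduct.sub_tmul, TensorProduct.tmul_sub, Pi.mul_apply, smul_sub,
        mul_comm (w _)]
      abel

/-- Here `1` is `(1, 1)`, the unit of the componentwise product on `k²`: the adjoint action of `g`
is that of the diagonal in `g × g`. -/
theorem adSym_eq (X : g) : adSym k g X = symDer (brMap k g (X ⊗ₜ 1)) := by
  rw [adSym]
  congr 1
  ext Y i
  simp [brMap_tmul]

theorem adjoin_range_jMap : Algebra.adjoin k (Set.range (jMap k g)) = ⊤ := by
  set S := Algebra.adjoin k (Set.range (jMap k g))
  have h0 (X : g) : ι k X ⊗ₜ[k] 1 ∈ S :=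
    Algebra.subset_adjoin ⟨X ⊗ₜ Pi.single 0 1, by simp [jMap_tmul]⟩
  have h1 (X : g) : 1 ⊗ₜ[k] ι k X ∈ S :=
    Algebra.subset_adjoin ⟨X ⊗ₜ Pi.single 1 1, by simp [jMap_tmul]⟩
  have h0' (a : UniversalEnvelopingAlgebra k g) : a ⊗ₜ[k] 1 ∈ S := by
    induction a using induction_mul with
    | one => exact one_mem S
    | smul r a ha => rw [← TensorProduct.smul_tmul']; exact S.smul_mem ha r
    | add a b ha hb => rw [TensorProduct.add_tmul]; exact add_mem ha hb
    | mul X a ha => simpa using mul_mem (h0 X) ha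
  have h1' (a : UniversalEnvelopingAlgebra k g) : 1 ⊗ₜ[k] a ∈ S := by
    induction a using induction_mul with
    | one => exact one_mem S
    | smul r a ha => rw [TensorProduct.tmul_smul]; exact S.smul_mem ha r
    | add a b ha hb => rw [TensorProduct.tmul_add]; exact add_mem ha hb
    | mul X a ha => simpa using mul_mem (h1 X) ha
  refine eq_top_iff.2 fun t _ => ?_
  induction t with
  | zero => exact zero_mem S
  | add a b ha hb => exact add_mem (ha trivial) (hb trivial)
  | tmul a b => simpa using mul_mem (h0' a) (h1' b)

variable [CharZero k]

/-- Symmetrization `Sym(g ⊗ k²) → U(g) ⊗ U(g)` for the Lie algebra `g × g` is `σ`. -/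
theorem sigma_eq_symmetrize : sigma k g = symmetrize (jMap k g) := by
  refine linearMap_ext_ι_pow fun m n => ?_
  obtain ⟨X, Y, rfl⟩ := exists_eq_tmul_add_tmul m
  have h : symSplit k g (SymmetricAlgebra.ι k _ (X ⊗ₜ Pi.single 0 1 + Y ⊗ₜ Pi.single 1 1)) =
      SymmetricAlgebra.ι k g X ⊗ₜ 1 + 1 ⊗ₜ SymmetricAlgebra.ι k g Y := by
    simp [symSplit]
  have h' : jMap k g (X ⊗ₜ Pi.single 0 1 + Y ⊗ₜ Pi.single 1 1) = ι k X ⊗ₜ 1 + 1 ⊗ₜ ι k Y := by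
    simp [jMap_tmul]
  -- As the two factors commute, the binomial theorem applies on both sides, and `σ` matches the
  -- expansions term by term because it fixes powers in each factor.
  have hc : Commute (ι k X ⊗ₜ[k] (1 : UniversalEnvelopingAlgebra k g)) (1 ⊗ₜ ι k Y) := by
    simp [Commute, SemiconjBy]
  rw [symmetrize_ι_pow, sigma, LinearMap.comp_apply, AlgHom.toLinearMap_apply, map_pow, h, h',
    (Commute.all _ _).add_pow, hc.add_pow, map_sum]
  refine Finset.sum_congr rfl fun i _ => ?_
  have e (n : ℕ) (A : Type _) [Semiring A] (a : A) : a * (n : A) = n • a := by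
    rw [nsmul_eq_mul, Nat.cast_comm]
  rw [e, e, map_nsmul]
  simp [sigmaOne, symmetrize_ι_pow, Algebra.TensorProduct.tmul_pow]

/-- The star product action of one factor `g` of `g × g` on `Sym(g ⊗ k²)`. -/
def starHom (hg : LieModule.lowerCentralSeries k g g 2 = ⊥) (i : Fin 2) :
    g →ₗ⁅k⁆ Module.End k (SymG k g) where
  toFun X := starOp (brMap k g) (X ⊗ₜ Pi.single i 1)
  map_add' X Y := by rw [TensorProduct.add_tmul, starOp_add]
  map_smul' r X := by rw [← TensorProduct.smul_tmul', starOp_smul, RingHom.id_apply]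
  map_lie' {X Y} := by
    rw [LieRing.of_associative_ring_bracket,
      starOp_mul_sub (brMap k g) (brMap_brMap hg) brMap_self, brMap_tmul]
    congr 2
    ext j
    simp [Pi.single_apply]

theorem starHom_apply (hg : LieModule.lowerCentralSeries k g g 2 = ⊥) (i : Fin 2) (X : g) :
    starHom hg i X = starOp (brMap k g) (X ⊗ₜ Pi.single i 1) := rfl

/-- The idempotents of `k²` satisfy `e₀ e₁ = 0`, so the two copies of `g` have zero bracket; the
commutation then spreads from generators to the enveloping algebras. -/
theorem commute_lift_starHom (hg : LieModule.lowerCentralSeries k g g 2 = ⊥)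
    (a b : UniversalEnvelopingAlgebra k g) :
    Commute (lift k (starHom hg 0) a) (lift k (starHom hg 1) b) := by
  induction a using induction_mul with
  | one => simp
  | smul r a ha => rw [map_smul]; exact ha.smul_left r
  | add a b ha hb => rw [map_add]; exact ha.add_left hb
  | mul X a ha =>
    rw [map_mul, lift_ι_apply]
    refine Commute.mul_left ?_ ha
    clear ha
    induction b using induction_mul with
    | one => simp
    | smul r a ha => rw [map_smul]; exact ha.smul_right r
    | add a b ha hb => rw [map_add]; exact ha.add_right hb
    | mul Y b hb =>
      rw [map_mul, lift_ι_apply]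
      refine Commute.mul_right ?_ hb
      have h := starOp_mul_sub (brMap k g) (brMap_brMap hg) brMap_self
        (X ⊗ₜ Pi.single 0 1) (Y ⊗ₜ Pi.single 1 1)
      have h0 : (Pi.single 0 1 * Pi.single 1 1 : Fin 2 → k) = 0 := by
        ext i; fin_cases i <;> simp
      -- Writing `0` as `0 • 0` lets homogeneity of `starOp` show that `starOp` of zero is zero.
      rw [brMap_tmul, h0, TensorProduct.tmul_zero, ← zero_smul k (0 : g ⊗[k] (Fin 2 → k)),
        starOp_smul, zero_smul, sub_eq_zero] at h
      exact h

/-- The required action of `U(g) ⊗ U(g)` comes from universal properties alone: each copy of `g`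
acts by the star product, and the two actions commute. -/
theorem sigma_bijective (hg : LieModule.lowerCentralSeries k g g 2 = ⊥) :
    Function.Bijective (sigma k g) := by
  rw [sigma_eq_symmetrize]
  refine symmetrize_bijective (brMap k g) (jMap k g) (brMap_brMap hg) brMap_self jMap_mul_sub
    (Algebra.TensorProduct.lift (lift k (starHom hg 0)) (lift k (starHom hg 1))
      (commute_lift_starHom hg)) (fun m => ?_) adjoin_range_jMap
  obtain ⟨X, Y, rfl⟩ := exists_eq_tmul_add_tmul m
  rw [starOp_add, map_add, map_add, jMap_tmul, jMap_tmul]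
  simp [-ι_apply, lift_ι_apply, starHom_apply]

theorem sigma_adSym (hg : LieModule.lowerCentralSeries k g g 2 = ⊥) (X : g) (f : SymG k g) :
    sigma k g (adSym k g X f) =
      primitiveHom k g X * sigma k g f - sigma k g f * primitiveHom k g X := by
  have h : jMap k g (X ⊗ₜ 1) = primitiveHom k g X := by
    simp [jMap_tmul, primitiveHom_apply]
  rw [sigma_eq_symmetrize, adSym_eq, ← h]
  exact symmetrize_symDer (brMap k g) (jMap k g) (brMap_brMap hg) jMap_mul_sub _ f

end Double

/-! ### Conjugation coinvariants as Lie algebra coinvariants -/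

section Conj

attribute [local instance 100] LieRing.ofAssociativeRing

open UniversalEnvelopingAlgebra Coalgebra

variable {k g : Type*} [Field k] [LieRing g] [LieAlgebra k g]

/-- `X` is primitive and the antipode reverses products with `S X = -X`, so a left factor `X` of `h`
acts as the outermost commutator. -/
theorem adjoint_ι_mul (X : g) (h a : UniversalEnvelopingAlgebra k g) :
    adjoint k _ (ι k X * h) a = ι k X * adjoint k _ h a - adjoint k _ h a * ι k X := by
  simp only [adjoint, LinearMap.comp_apply, Bialgebra.comul_mul, comul_ι]
  induction comul (R := k) h with
  | zero => simp
  | add s t hs ht =>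
    rw [mul_add, map_add, map_add, LinearMap.add_apply, hs, ht, LinearMap.add_apply]
    noncomm_ring
  | tmul s t =>
    simp only [add_mul, Algebra.TensorProduct.tmul_mul_tmul, one_mul, map_add,
      TensorProduct.lift.tmul, LinearMap.add_apply, LinearMap.compl₁₂_apply, LinearMap.comp_apply,
      LinearMap.llcomp_apply, LinearMap.flip_apply, LinearMap.mul_apply']
    have : HopfAlgebra.antipode k (ι k X * t) = -(HopfAlgebra.antipode k t * ι k X) := by
      change antipodeMap k g _ = -(antipodeMap k g _ * _)
      rw [antipodeMap_mul, antipodeMap_ι, mul_neg]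
    rw [this]
    noncomm_ring

theorem conjAct_ι_mul (X : g) (h : UniversalEnvelopingAlgebra k g)
    (t : UniversalEnvelopingAlgebra k g ⊗[k] UniversalEnvelopingAlgebra k g) :
    conjAct k _ (ι k X * h) t =
      primitiveHom k g X * conjAct k _ h t - conjAct k _ h t * primitiveHom k g X := by
  induction t with
  | zero => simp
  | add a b ha hb => rw [map_add, ha, hb, map_add]; noncomm_ring
  | tmul a b =>
    simp only [conjAct, LinearMap.comp_apply, Bialgebra.comul_mul, comul_ι]
    induction comul (R := k) h with
    | zero => simp
    | add s t hs ht =>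
      rw [mul_add, map_add, map_add, LinearMap.add_apply, hs, ht, map_add, map_add,
        LinearMap.add_apply]
      noncomm_ring
    | tmul s t =>
      simp only [add_mul, mul_add, Algebra.TensorProduct.tmul_mul_tmul, one_mul, map_add,
        TensorProduct.map_tmul, LinearMap.add_apply, TensorProduct.homTensorHomMap_apply,
        adjoint_ι_mul, TensorProduct.sub_tmul, TensorProduct.tmul_sub, primitiveHom_apply, mul_one]
      abel

theorem conjAct_ι (X : g)
    (t : UniversalEnvelopingAlgebra k g ⊗[k] UniversalEnvelopingAlgebra k g) :
    conjAct k _ (ι k X) t = primitiveHom k g X * t - t * primitiveHom k g X := by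
  have := conjAct_ι_mul X 1 t
  rwa [mul_one, one_conjAct] at this

theorem commutator_mem_conjSpan (X : g)
    (t : UniversalEnvelopingAlgebra k g ⊗[k] UniversalEnvelopingAlgebra k g) :
    primitiveHom k g X * t - t * primitiveHom k g X ∈
      conjSpan k (UniversalEnvelopingAlgebra k g) := by
  have := conjAct_sub_mem k _ (ι k X) t
  rwa [counit_ι, map_zero, sub_zero, conjAct_ι] at this

/-- The conjugation coinvariants are the coinvariants of the adjoint action of `g`. -/
theorem conjSpan_eq_span : conjSpan k (UniversalEnvelopingAlgebra k g) =
    Submodule.span k {y | ∃ (X : g)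
      (t : UniversalEnvelopingAlgebra k g ⊗[k] UniversalEnvelopingAlgebra k g),
      y = primitiveHom k g X * t - t * primitiveHom k g X} := by
  apply le_antisymm
  · refine Submodule.span_le.2 ?_
    rintro _ ⟨h, a, b, rfl⟩
    rw [SetLike.mem_coe]
    generalize a ⊗ₜ[k] b = t
    induction h using induction_mul with
    | one => simp
    | smul r h ih =>
      have : r • h - algebraMap k _ (counit (R := k) (r • h)) =
          r • (h - algebraMap k _ (counit (R := k) h)) := by
        rw [map_smul, smul_eq_mul, map_mul, smul_sub, ← Algebra.smul_def]
      rw [this, map_smul]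
      exact Submodule.smul_mem _ r ih
    | add a b ha hb =>
      have : a + b - algebraMap k (UniversalEnvelopingAlgebra k g) (counit (R := k) (a + b)) =
          (a - algebraMap k _ (counit (R := k) a)) + (b - algebraMap k _ (counit (R := k) b)) := by
        rw [map_add, map_add]; abel
      rw [this, map_add]
      exact add_mem ha hb
    -- Since `ε(X h) = 0`, the generator is a single commutator of `ΔX` with `h ⊛ t`; no inductive
    -- hypothesis is needed.
    | mul X h _ =>
      rw [Bialgebra.counit_mul, counit_ι, zero_mul, map_zero, sub_zero, conjAct_ι_mul]
      exact Submodule.subset_span ⟨X, _, rfl⟩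
  · refine Submodule.span_le.2 ?_
    rintro _ ⟨X, t, rfl⟩
    exact commutator_mem_conjSpan X t

variable [CharZero k]

theorem map_sigma_adSpan (hg : LieModule.lowerCentralSeries k g g 2 = ⊥) :
    (adSpan k g).map (sigma k g) = conjSpan k (UniversalEnvelopingAlgebra k g) := by
  rw [adSpan, Submodule.map_span, conjSpan_eq_span]
  congr 1
  ext y
  constructor
  · rintro ⟨_, ⟨X, f, rfl⟩, rfl⟩
    exact ⟨X, _, sigma_adSym hg X f⟩
  · rintro ⟨X, t, rfl⟩
    -- Surjectivity of `σ` is what makes every commutator, and not merely some, the image of an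
    -- adjoint derivative.
    obtain ⟨f, rfl⟩ := (sigma_bijective hg).2 t
    exact ⟨_, ⟨X, f, rfl⟩, sigma_adSym hg X f⟩

/-- The isomorphism induced by `σ` on coinvariants. -/
def sigmaBar (hg : LieModule.lowerCentralSeries k g g 2 = ⊥) :
    SymBar k g ≃ₗ[k] HBar k (UniversalEnvelopingAlgebra k g) :=
  Submodule.Quotient.equiv _ _ (LinearEquiv.ofBijective (sigma k g) (sigma_bijective hg))
    (map_sigma_adSpan hg)

theorem sigmaBar_mk (hg : LieModule.lowerCentralSeries k g g 2 = ⊥) (f : SymG k g) :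
    sigmaBar hg (Submodule.Quotient.mk f) = Submodule.Quotient.mk (sigma k g f) := rfl

end Conj

/-! ### Divided powers in a noncommutative algebra -/

section DividedPower

variable (k : Type*) {R S : Type*} [Field k] [Ring R] [Algebra k R] [Ring S] [Algebra k S]

/-- The divided power `rⁿ / n!`. -/
def dpow (n : ℕ) (r : R) : R := (n.factorial : k)⁻¹ • r ^ n

theorem dpow_zero_left (r : R) : dpow k 0 r = 1 := by simp [dpow]

theorem map_dpow (f : R →ₐ[k] S) (n : ℕ) (r : R) : f (dpow k n r) = dpow k n (f r) := by
  rw [dpow, dpow, map_smul, map_pow]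

theorem dpow_zero_right (n : ℕ) : dpow k n (0 : R) = if n = 0 then 1 else 0 := by
  cases n <;> simp [dpow]

variable {k}

theorem _root_.SemiconjBy.dpow_right {e r s : R} (h : SemiconjBy e r s) (n : ℕ) :
    SemiconjBy e (dpow k n r) (dpow k n s) := by
  rw [SemiconjBy, dpow, dpow, mul_smul_comm, smul_mul_assoc, (h.pow_right n).eq]

theorem _root_.Commute.dpow_right {r s : R} (h : Commute r s) (n : ℕ) :
    Commute r (dpow k n s) := SemiconjBy.dpow_right h n

variable [CharZero k]

theorem dpow_add {r s : R} (h : Commute r s) (n : ℕ) :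
    dpow k n (r + s) = ∑ p ∈ Finset.HasAntidiagonal.antidiagonal n, dpow k p.1 r * dpow k p.2 s := by
  rw [dpow, h.add_pow', Finset.smul_sum]
  refine Finset.sum_congr rfl fun p hp => ?_
  rw [Finset.HasAntidiagonal.mem_antidiagonal] at hp
  have h1 : (p.1.factorial : k) ≠ 0 := Nat.cast_ne_zero.2 p.1.factorial_ne_zero
  have h2 : (p.2.factorial : k) ≠ 0 := Nat.cast_ne_zero.2 p.2.factorial_ne_zero
  rw [dpow, dpow, smul_mul_smul_comm, ← Nat.cast_smul_eq_nsmul k, smul_smul, ← hp,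
    Nat.cast_add_choose]
  congr 1
  have h3 : ((p.1 + p.2).factorial : k) ≠ 0 := Nat.cast_ne_zero.2 (p.1 + p.2).factorial_ne_zero
  field_simp

/-- If `[x, r] = q` commutes with `r` then `[x, rⁿ⁺¹/(n+1)!] = q rⁿ/n!`. -/
theorem mul_dpow_succ {x r q : R} (hq : x * r = r * x + q) (h : Commute q r) (n : ℕ) :
    x * dpow k (n + 1) r = dpow k (n + 1) r * x + q * dpow k n r := by
  have key (n : ℕ) : x * r ^ (n + 1) = r ^ (n + 1) * x + ((n : k) + 1) • (q * r ^ n) := by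
    induction n with
    | zero => simpa using hq
    | succ n ih =>
      have h1 : r ^ (n + 1) * q = q * r ^ (n + 1) := ((h.pow_right (n + 1)).eq).symm
      rw [pow_succ, ← mul_assoc, ih, add_mul, mul_assoc, hq, smul_mul_assoc, mul_assoc, mul_assoc,
        ← pow_succ, mul_add, h1, ← mul_assoc]
      push_cast
      module
  rw [dpow, dpow, mul_smul_comm, key, smul_add, smul_mul_assoc, smul_smul, mul_smul_comm]
  congr 2
  rw [Nat.factorial_succ]
  have h1 : (n.factorial : k) ≠ 0 := Nat.cast_ne_zero.2 n.factorial_ne_zero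
  have h2 : (n : k) + 1 ≠ 0 := Nat.cast_add_one_ne_zero n
  push_cast
  field_simp

end DividedPower

/-! ### Formal exponentials -/

section Exponential

open PowerSeries

theorem monomial_one_eq {R : Type*} [Ring R] (z : R) : (monomial 1 z : R⟦X⟧) = C z * X := by
  rw [X_eq, ← monomial_zero_eq_C_apply, monomial_mul_monomial, mul_one, zero_add]


variable (k : Type*) {R : Type*} [Field k] [Ring R] [Algebra k R]

/-- The exponential series `∑ rⁿ tⁿ / n!` of an element of a noncommutative algebra. -/
def expS (r : R) : R⟦X⟧ := PowerSeries.mk fun n => dpow k n r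

theorem coeff_expS (n : ℕ) (r : R) : coeff n (expS k r) = dpow k n r := coeff_mk _ _

theorem expS_zero : expS k (0 : R) = 1 := by
  ext n
  rw [coeff_expS, dpow_zero_right, coeff_one]

variable {k}

/-- Conjugating an exponential conjugates its exponent. The lemma is used also with `R` a power
series ring and `e` itself an exponential. -/
theorem C_mul_expS {e r s : R} (h : SemiconjBy e r s) :
    SemiconjBy (C e) (expS k r) (expS k s) := by
  ext n
  rw [coeff_C_mul, coeff_mul_C, coeff_expS, coeff_expS, (h.dpow_right n).eq]

theorem commute_expS {r s : R} (h : Commute r s) : Commute (expS k r) (expS k s) := by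
  ext n
  rw [coeff_mul, coeff_mul, ← Finset.Nat.sum_antidiagonal_swap]
  refine Finset.sum_congr rfl fun p _ => ?_
  simp only [coeff_expS, Prod.fst_swap, Prod.snd_swap]
  exact ((h.dpow_right _).symm.dpow_right _).symm

variable [CharZero k]

theorem expS_add {r s : R} (h : Commute r s) : expS k (r + s) = expS k r * expS k s := by
  ext n
  simp only [coeff_mul, coeff_expS, dpow_add h]

/-- This is `exp(sx) y exp(-sx) = y + s z`: the adjoint series stops after one term because `z`
commutes with `x`. -/
theorem expS_mul_C {x y z : R} (h : x * y - y * x = z) (hz : Commute z x) :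
    expS k x * C y = (C y + monomial 1 z) * expS k x := by
  ext n
  rw [add_mul, map_add, coeff_mul_C, coeff_C_mul, coeff_expS]
  cases n with
  | zero => simp [dpow, coeff_mul, coeff_monomial]
  | succ n =>
    have h1 : y * x = x * y + -z := by rw [← h]; abel
    have h2 : coeff (n + 1) (monomial 1 z * expS k x) = z * dpow k n x := by
      rw [← coeff_expS]
      rw [monomial_one_eq, mul_assoc, coeff_C_mul, coeff_succ_X_mul]
    rw [h2, mul_dpow_succ h1 hz.neg_left]
    noncomm_ring

end Exponential

/-! ### The formal Heisenberg group, with inner variable `s` and outer variable `t` -/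

section Heisenberg

open PowerSeries

variable {k R : Type*} [Field k] [Ring R] [Algebra k R]

/-- The element `exp(c s t z) exp(a s x) exp(b t y)` of the Heisenberg group. -/
def heis (x y z : R) (a b c : k) : R⟦X⟧⟦X⟧ :=
  expS k (monomial 1 (c • z)) * C (expS k (a • x)) * expS k (C (b • y))

variable {x y z : R}

theorem smul_commutator (h : x * y - y * x = z) (a b : k) :
    (a • x) * (b • y) - (b • y) * (a • x) = (a * b) • z := by
  rw [← h, smul_mul_smul_comm, smul_mul_smul_comm, smul_sub, mul_comm b]

theorem heis_zero : heis x y z (0 : k) 0 0 = 1 := by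
  simp [heis, expS_zero]

theorem commute_monomial_expS {u v : R} (h : Commute u v) :
    Commute (monomial 1 u) (expS k v) := by
  have : Commute (C u) (expS k v) := C_mul_expS h
  rw [monomial_one_eq]
  exact this.mul_left (commute_X _).symm

theorem commute_monomial_C {u v : R} (h : Commute u v) :
    Commute (monomial 1 u) (C v) := by
  rw [← monomial_zero_eq_C_apply]
  simp only [Commute, SemiconjBy, monomial_mul_monomial, h.eq, add_comm]

theorem commute_heis_one {u v : R} (h : Commute u v) :
    Commute (expS k (monomial 1 u)) (C (expS k v)) :=
  (C_mul_expS (commute_monomial_expS h).symm).symm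

theorem commute_heis_two {u v : R} (h : Commute u v) :
    Commute (expS k (monomial 1 u)) (expS k (C v)) :=
  commute_expS (commute_monomial_C h)

variable [CharZero k]

/-- Conjugation by `exp(sx)` changes the exponent `t y` into `t (y + s z)`, and the central summand
then splits off. -/
theorem heis_swap (h : x * y - y * x = z) (hx : Commute z x) (hy : Commute z y) :
    C (expS k x) * expS k (C y) =
      expS k (monomial 1 z) * expS k (C y) * C (expS k x) := by
  rw [← expS_add (commute_monomial_C hy), add_comm]
  exact C_mul_expS (expS_mul_C h hx)

/-- The cocycle `-a' b` is the cost of moving `exp(b t y)` to the right past `exp(a' s x)`; all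
other factors combine by additivity of commuting exponentials. -/
theorem heis_mul (h : x * y - y * x = z) (hx : Commute z x) (hy : Commute z y)
    (a b c a' b' c' : k) :
    heis x y z a b c * heis x y z a' b' c' =
      heis x y z (a + a') (b + b') (c + c' - a' * b) := by
  have hz (r s : k) : Commute (expS k (monomial 1 (r • z))) (expS k (monomial 1 (s • z))) := by
    refine commute_expS ?_
    simp only [Commute, SemiconjBy, monomial_mul_monomial, smul_mul_smul_comm, mul_comm]
  have hzx (r s : k) := commute_heis_one (k := k) ((hx.smul_left r).smul_right s)
  have hzy (r s : k) := commute_heis_two (k := k) ((hy.smul_left r).smul_right s)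
  have hxy := heis_swap (k := k) (smul_commutator h a' b) ((hx.smul_left (a' * b)).smul_right a')
    ((hy.smul_left (a' * b)).smul_right b)
  have hzz (r s : k) : expS k (monomial 1 ((r + s) • z)) =
      expS k (monomial 1 (r • z)) * expS k (monomial 1 (s • z)) := by
    rw [add_smul, map_add, expS_add]
    simp only [Commute, SemiconjBy, monomial_mul_monomial, smul_mul_smul_comm, mul_comm]
  have hxx : expS k ((a + a') • x) = expS k (a • x) * expS k (a' • x) := by
    rw [add_smul, expS_add (((Commute.refl x).smul_left a).smul_right a')]
  have hyy : expS k (C ((b + b') • y)) = expS k (C (b • y)) * expS k (C (b' • y)) := by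
    rw [add_smul, map_add, expS_add ((((Commute.refl y).smul_left b).smul_right b').map C)]
  have hyx : expS k (C (b • y)) * C (expS k (a' • x)) =
      expS k (monomial 1 ((-(a' * b)) • z)) * (C (expS k (a' • x)) * expS k (C (b • y))) := by
    rw [hxy, ← mul_assoc, ← mul_assoc, ← hzz, neg_add_cancel, zero_smul, map_zero, expS_zero,
      one_mul]
  simp only [heis]
  rw [sub_eq_add_neg, hzz, hzz, hxx, hyy, map_mul]
  have hyx' (T : R⟦X⟧⟦X⟧) : expS k (C (b • y)) * (C (expS k (a' • x)) * T) =
      expS k (monomial 1 ((-(a' * b)) • z)) * (C (expS k (a' • x)) * (expS k (C (b • y)) * T)) := by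
    rw [← mul_assoc, hyx, mul_assoc, mul_assoc]
  simp only [mul_assoc]
  rw [← (hzy c' b).left_comm, ← (hzx c' a).left_comm, hyx', ← (hzx (-(a' * b)) a).left_comm]

end Heisenberg

/-! ### Words of the free group in the Heisenberg group -/

section HeisenbergWords

open PowerSeries

variable {k R : Type*} [Field k] [CharZero k] [Ring R] [Algebra k R] {x y z : R}

/-- The value of a word in `F₂` on the pair `(exp(s x), exp(t y))`. -/
theorem exists_word_eq_heis (h : x * y - y * x = z) (hx : Commute z x) (hy : Commute z y)
    (u : FreeGroup (Fin 2) →* (R⟦X⟧⟦X⟧)ˣ) (h0 : (u (.of 0)).val = C (expS k x))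
    (h1 : (u (.of 1)).val = expS k (C y)) (w : FreeGroup (Fin 2)) :
    ∃ c : k, (u w).val =
      heis x y z ((expVec w).toAdd 0 : k) ((expVec w).toAdd 1 : k) c := by
  have h0' : (u (.of 0)).val = heis x y z (1 : k) 0 0 := by simp [heis, h0, expS_zero]
  have h1' : (u (.of 1)).val = heis x y z (0 : k) 1 0 := by simp [heis, h1, expS_zero]
  -- Negating coordinates inverts up to the central term `a b`, which is zero for a generator; only
  -- generators are inverted in the induction.
  have hinv (e : R⟦X⟧⟦X⟧ˣ) (a b : k) (he : e.val = heis x y z a b 0) (hab : a * b = 0) :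
      (e⁻¹).val = heis x y z (-a) (-b) 0 := by
    refine Units.inv_eq_of_mul_eq_one_right ?_
    rw [he, heis_mul h hx hy]
    simp [hab, heis_zero]
  induction w using FreeGroup.induction_on with
  | C1 => exact ⟨0, by simp [heis_zero]⟩
  | of i =>
    refine ⟨0, ?_⟩
    fin_cases i
    · simpa [expVec] using h0'
    · simpa [expVec] using h1'
  | inv_of i _ =>
    refine ⟨0, ?_⟩
    fin_cases i
    · simpa [expVec] using hinv _ _ _ h0' (by simp)
    · simpa [expVec] using hinv _ _ _ h1' (by simp)
  | mul v w hv hw =>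
    obtain ⟨c, hc⟩ := hv
    obtain ⟨c', hc'⟩ := hw
    refine ⟨c + c' - ((expVec w).toAdd 0 : k) * ((expVec v).toAdd 1 : k), ?_⟩
    rw [map_mul, Units.val_mul, hc, hc', heis_mul h hx hy, map_mul]
    simp

end HeisenbergWords

/-! ### Coefficients modulo multiples of the central element -/

section Coefficients

open PowerSeries

variable {k R : Type*} [Field k] [Ring R] [Algebra k R]

theorem dpow_C (n : ℕ) (r : R) : dpow k n (C r) = C (dpow k n r) := by
  ext m
  rw [dpow, dpow, coeff_smul, ← map_pow, coeff_C, coeff_C]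
  split_ifs <;> simp

theorem pow_eq_smul_dpow [CharZero k] (n : ℕ) (r : R) :
    r ^ n = (n.factorial : k) • dpow k n r := by
  rw [dpow, smul_smul, mul_inv_cancel₀ (Nat.cast_ne_zero.2 n.factorial_ne_zero), one_smul]

theorem monomial_one_pow (ζ : R) (n : ℕ) : (monomial 1 ζ : R⟦X⟧) ^ n = C (ζ ^ n) * X ^ n := by
  induction n with
  | zero => simp
  | succ n ih =>
    rw [pow_succ, ih, monomial_one_eq, pow_succ, map_mul, mul_assoc, ← mul_assoc (X ^ n),
      ((commute_X (C ζ)).pow_right n).symm.eq, pow_succ]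
    simp only [mul_assoc]

/-- The coefficients of `exp(s t ζ) exp(s p) exp(t q)`, up to multiples of `ζ`. -/
theorem coeff_heis_sub_mem (W : Submodule k R) (ζ p q : R)
    (hW : ∀ l i j : ℕ, ζ ^ (l + 1) * (p ^ i * q ^ j) ∈ W) (m n : ℕ) :
    coeff m (coeff n (expS k (monomial 1 ζ) * (C (expS k p) * expS k (C q)))) -
      dpow k m p * dpow k n q ∈ W := by
  have hF (j i : ℕ) : coeff i (coeff j (C (expS k p) * expS k (C q))) =
      dpow k i p * dpow k j q := by
    rw [coeff_C_mul, coeff_expS, dpow_C, coeff_mul_C, coeff_expS]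
  -- Splitting off the index `0` of `exp(s t ζ)` isolates the main term; each remaining summand
  -- carries a positive power of `ζ`, or is zero when the `s`-degree is too small.
  rw [coeff_mul, Finset.Nat.sum_antidiagonal_eq_sum_range_succ_mk, Finset.sum_range_succ', map_add]
  simp only [coeff_expS, dpow_zero_left, one_mul, Nat.sub_zero, hF]
  rw [add_sub_cancel_right, map_sum]
  refine W.sum_mem fun i _ => ?_
  rw [dpow, monomial_one_pow, smul_mul_assoc, coeff_smul, mul_assoc, coeff_C_mul, coeff_X_pow_mul']
  refine W.smul_mem _ ?_
  split_ifs
  · rw [hF, dpow, dpow, smul_mul_smul_comm, mul_smul_comm]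
    exact W.smul_mem _ (hW _ _ _)
  · simp

end Coefficients

/-! ### Generating functions on `U(g) ⊗ U(g)` -/

section GeneratingFunction

attribute [local instance 100] LieRing.ofAssociativeRing

open PowerSeries UniversalEnvelopingAlgebra Coalgebra WithConv

variable {k g : Type*} [Field k] [CharZero k] [LieRing g] [LieAlgebra k g]

/-- Coefficientwise form of the fact that the exponential of a primitive element is group-like. -/
theorem comul_dpow_ι (x : g) (n : ℕ) : comul (R := k) (dpow k n (ι k x)) =
    ∑ p ∈ Finset.HasAntidiagonal.antidiagonal n, dpow k p.1 (ι k x) ⊗ₜ[k] dpow k p.2 (ι k x) := by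
  have h := map_dpow k (Bialgebra.comulAlgHom k (UniversalEnvelopingAlgebra k g)) n (ι k x)
  rw [Bialgebra.comulAlgHom_apply, Bialgebra.comulAlgHom_apply, comul_ι, dpow_add] at h
  · rw [h]
    refine Finset.sum_congr rfl fun p _ => ?_
    have h1 := map_dpow k (Algebra.TensorProduct.includeLeft : UniversalEnvelopingAlgebra k g →ₐ[k]
      UniversalEnvelopingAlgebra k g ⊗[k] UniversalEnvelopingAlgebra k g) p.1 (ι k x)
    have h2 := map_dpow k (Algebra.TensorProduct.includeRight : UniversalEnvelopingAlgebra k g →ₐ[k]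
      UniversalEnvelopingAlgebra k g ⊗[k] UniversalEnvelopingAlgebra k g) p.2 (ι k x)
    rw [Algebra.TensorProduct.includeLeft_apply, Algebra.TensorProduct.includeLeft_apply] at h1
    rw [Algebra.TensorProduct.includeRight_apply, Algebra.TensorProduct.includeRight_apply] at h2
    rw [← h1, ← h2, Algebra.TensorProduct.tmul_mul_tmul, one_mul, mul_one]
  · simp [Commute, SemiconjBy]

omit [CharZero k] in
theorem counit_dpow_ι (x : g) (n : ℕ) :
    counit (R := k) (dpow k n (ι k x)) = if n = 0 then 1 else 0 := by
  have h := map_dpow k (Bialgebra.counitAlgHom k (UniversalEnvelopingAlgebra k g)) n (ι k x)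
  rwa [Bialgebra.counitAlgHom_apply, Bialgebra.counitAlgHom_apply, counit_ι, dpow_zero_right] at h

/-- The generating function `∑ f(xᵐ/m! ⊗ yⁿ/n!) sᵐ tⁿ` of a linear map `f` on `U(g) ⊗ U(g)`. It is
multiplicative for the convolution product. -/
def genFun {A : Type*} [Ring A] [Algebra k A] (x y : g) :
    WithConv (UniversalEnvelopingAlgebra k g ⊗[k] UniversalEnvelopingAlgebra k g →ₗ[k] A) →*
      A⟦X⟧⟦X⟧ where
  toFun f := PowerSeries.mk fun n => PowerSeries.mk fun m =>
    f.ofConv (dpow k m (ι k x) ⊗ₜ dpow k n (ι k y))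
  map_one' := by
    ext n m
    rw [coeff_mk, coeff_mk, LinearMap.convOne_def]
    simp only [LinearMap.comp_apply, TensorProduct.counit_tmul, counit_dpow_ι]
    rw [coeff_one]
    split_ifs with h1 h2 h2 <;> simp [coeff_one, h2]
  map_mul' f f' := by
    ext n m
    rw [coeff_mk, coeff_mk, coeff_mul, map_sum, LinearMap.convMul_def]
    -- The coproduct of divided powers is a sum over antidiagonals, which is exactly the Cauchy
    -- product in each of the two variables.
    simp only [coeff_mul, coeff_mk, LinearMap.comp_apply, TensorProduct.comul_tmul, comul_dpow_ι,
      TensorProduct.sum_tmul, TensorProduct.tmul_sum, map_sum]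
    refine Finset.sum_congr rfl fun p _ => Finset.sum_congr rfl fun q _ => ?_
    simp

theorem coeff_genFun {A : Type*} [Ring A] [Algebra k A] (x y : g) (f : WithConv
    (UniversalEnvelopingAlgebra k g ⊗[k] UniversalEnvelopingAlgebra k g →ₗ[k] A)) (m n : ℕ) :
    coeff m (coeff n (genFun x y f)) = f.ofConv (dpow k m (ι k x) ⊗ₜ dpow k n (ι k y)) := by
  simp [genFun]

theorem genFun_fstHom {A : Type*} [Ring A] [Algebra k A] (x y : g)
    (f : UniversalEnvelopingAlgebra k g →ₐ[k] A) :
    genFun x y (postcomp f (toConv (fstHom k _ _).toLinearMap)) = C (expS k (f (ι k x))) := by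
  ext n m
  rw [coeff_genFun, coeff_C]
  change f (fstHom k _ _ _) = _
  rw [fstHom_tmul, counit_dpow_ι]
  split_ifs <;> simp [map_dpow, coeff_expS]

theorem genFun_sndHom {A : Type*} [Ring A] [Algebra k A] (x y : g)
    (f : UniversalEnvelopingAlgebra k g →ₐ[k] A) :
    genFun x y (postcomp f (toConv (sndHom k _ _).toLinearMap)) = expS k (C (f (ι k y))) := by
  ext n m
  rw [coeff_genFun, coeff_expS, dpow_C, coeff_C]
  change f (sndHom k _ _ _) = _
  rw [sndHom_tmul, counit_dpow_ι]
  split_ifs <;> simp [map_dpow]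

omit [CharZero k] in
theorem ι_commute (hg : LieModule.lowerCentralSeries k g g 2 = ⊥) (x y w : g) :
    Commute (ι k ⁅x, y⁆) (ι k w) := by
  have h := ι_mul_sub (k := k) ⁅x, y⁆ w
  rw [← lie_skew ⁅x, y⁆ w, lie_lie_eq_zero hg, neg_zero, map_zero, sub_eq_zero] at h
  exact h

/-- Generating functions turn convolution into multiplication, so words in the two projections
become words in `exp(sx)` and `exp(ty)`. The map `f` will be the inclusion of either tensor factor.
-/
theorem exists_genFun_word (hg : LieModule.lowerCentralSeries k g g 2 = ⊥) {A : Type*} [Ring A]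
    [Algebra k A] (x y : g) (f : UniversalEnvelopingAlgebra k g →ₐ[k] A) (w : FreeGroup (Fin 2)) :
    ∃ c : k, genFun x y (postcomp f (toConv (wordHom (fstHom k _ _)
        (sndHom k (UniversalEnvelopingAlgebra k g) _) w).toLinearMap)) =
      heis (f (ι k x)) (f (ι k y)) (f (ι k ⁅x, y⁆)) ((expVec w).toAdd 0 : k)
        ((expVec w).toAdd 1 : k) c := by
  have := exists_word_eq_heis (k := k) (x := f (ι k x)) (y := f (ι k y)) (z := f (ι k ⁅x, y⁆))
    (by rw [← ι_mul_sub, map_sub, map_mul, map_mul]) ((ι_commute hg x y x).map f)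
    ((ι_commute hg x y y).map f)
    ((Units.map ((genFun x y).comp (postcomp f))).comp (word (fstHom k _ _)
      (sndHom k (UniversalEnvelopingAlgebra k g) (UniversalEnvelopingAlgebra k g))))
    (by
      rw [← genFun_fstHom x y f]
      simp [word, convUnit])
    (by
      rw [← genFun_sndHom x y f]
      simp [word, convUnit]) w
  exact this

omit [CharZero k] in
-- This makes the generating function of a pair of words the product of those of its two components,
-- placed in commuting tensor factors.
theorem pair_eq_convMul (p q : UniversalEnvelopingAlgebra k g ⊗[k] UniversalEnvelopingAlgebra k g
      →ₗc[k] UniversalEnvelopingAlgebra k g) :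
    toConv (pair p q).toLinearMap =
      postcomp Algebra.TensorProduct.includeLeft (toConv p.toLinearMap) *
        postcomp Algebra.TensorProduct.includeRight (toConv q.toLinearMap) := by
  rw [LinearMap.convMul_def]
  congr 1
  change TensorProduct.map p.toLinearMap q.toLinearMap ∘ₗ comul = _
  rw [← LinearMap.comp_assoc]
  congr 1
  ext a b c d
  simp [postcomp]

end GeneratingFunction

/-! ### Surjectivity onto `GL₂(ℤ)` -/

section Surjective

theorem mem_range_autToGL (f f' : FreeGroup (Fin 2) →* FreeGroup (Fin 2))
    (h : f'.comp f = .id _) (h' : f.comp f' = .id _) (P : GL (Fin 2) ℤ)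
    (hP : P.val = expMatrix f) : P ∈ autToGL.range := by
  -- The inverse compensates for the `ψ⁻¹` in the definition of `autToGL`.
  refine ⟨(MonoidHom.toMulEquiv f f' h h')⁻¹, Units.ext ?_⟩
  rw [hP]
  change expMatrix ((MonoidHom.toMulEquiv f f' h h')⁻¹⁻¹).toMonoidHom = _
  rw [inv_inv]
  rfl

theorem toGL_mem_range (P : Matrix.SpecialLinearGroup (Fin 2) ℤ) :
    Matrix.SpecialLinearGroup.toGL P ∈ autToGL.range := by
  have h : (⊤ : Subgroup (Matrix.SpecialLinearGroup (Fin 2) ℤ)) ≤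
      autToGL.range.comap Matrix.SpecialLinearGroup.toGL := by
    rw [← SpecialLinearGroup.SL2Z_generators, Subgroup.closure_le]
    rintro _ (rfl | rfl)
    · refine mem_range_autToGL (FreeGroup.lift ![(.of 1)⁻¹, .of 0])
        (FreeGroup.lift ![.of 1, (.of 0)⁻¹]) ?_ ?_ _ ?_
      · ext i : 1; fin_cases i <;> simp
      · ext i : 1; fin_cases i <;> simp
      · ext i j
        fin_cases i <;> fin_cases j <;> simp [expMatrix, expVec, ModularGroup.S] <;> rfl
    · refine mem_range_autToGL (FreeGroup.lift ![.of 0 * .of 1, .of 1])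
        (FreeGroup.lift ![.of 0 * (.of 1)⁻¹, .of 1]) ?_ ?_ _ ?_
      · ext i : 1; fin_cases i <;> simp
      · ext i : 1; fin_cases i <;> simp
      · ext i j
        fin_cases i <;> fin_cases j <;> simp [expMatrix, expVec, ModularGroup.T] <;> rfl
  exact h (Subgroup.mem_top P)

theorem autToGL_surjective : Function.Surjective autToGL := by
  rw [← MonoidHom.range_eq_top]
  refine eq_top_iff.2 fun P _ => ?_
  have hdet : P.val.det = 1 ∨ P.val.det = -1 := Int.isUnit_iff.1 (P.isUnit.map Matrix.detMonoidHom)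
  rcases hdet with h | h
  · have : P = Matrix.SpecialLinearGroup.toGL ⟨P.val, h⟩ := Units.ext rfl
    rw [this]
    exact toGL_mem_range _
  -- `D` is the matrix of the automorphism inverting `x₀`; multiplying by it reduces determinant
  -- `-1` to the case of `SL₂(ℤ)`.
  · let D : GL (Fin 2) ℤ := ⟨!![-1, 0; 0, 1], !![-1, 0; 0, 1], by simp [Matrix.one_fin_two],
      by simp [Matrix.one_fin_two]⟩
    have hD : D ∈ autToGL.range := by
      refine mem_range_autToGL (FreeGroup.lift ![(.of 0)⁻¹, .of 1])
        (FreeGroup.lift ![(.of 0)⁻¹, .of 1]) ?_ ?_ _ ?_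
      · ext i : 1; fin_cases i <;> simp
      · ext i : 1; fin_cases i <;> simp
      · ext i j
        fin_cases i <;> fin_cases j <;> simp [expMatrix, expVec, D]
    have hDP : D * P = Matrix.SpecialLinearGroup.toGL ⟨D.val * P.val, by
        rw [Matrix.det_mul, h]; simp [D, Matrix.det_fin_two]⟩ := Units.ext rfl
    have := toGL_mem_range ⟨D.val * P.val, by
        rw [Matrix.det_mul, h]; simp [D, Matrix.det_fin_two]⟩
    rw [← hDP] at this
    exact (Subgroup.mul_mem_cancel_left _ hD).1 this

theorem outToGL_surjective : Function.Surjective outToGL := by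
  intro P
  obtain ⟨ψ, rfl⟩ := autToGL_surjective P
  exact ⟨QuotientGroup.mk ψ, rfl⟩

end Surjective

/-! ### A spanning set adapted to the two factors -/

section SymSpan

variable {k g : Type*} [Field k] [CharZero k] [LieRing g] [LieAlgebra k g]

/-- `Sym(g ⊗ k²)` is spanned by the elements `(X ⊗ e₀)ᵐ (Y ⊗ e₁)ⁿ`. -/
theorem linearMap_eq_zero_of_ι_pow_mul_ι_pow {N : Type*} [AddCommGroup N] [Module k N]
    (φ : SymG k g →ₗ[k] N)
    (h : ∀ (X Y : g) (m n : ℕ), φ (SymmetricAlgebra.ι k _ (X ⊗ₜ Pi.single 0 1) ^ m *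
      SymmetricAlgebra.ι k _ (Y ⊗ₜ Pi.single 1 1) ^ n) = 0) : φ = 0 := by
  let θ (i : Fin 2) : SymmetricAlgebra k g →ₐ[k] SymG k g :=
    symMap ((TensorProduct.mk k g (Fin 2 → k)).flip (Pi.single i 1))
  have hθ (i : Fin 2) (X : g) : θ i (SymmetricAlgebra.ι k g X) =
      SymmetricAlgebra.ι k _ (X ⊗ₜ Pi.single i 1) := by simp [θ]
  -- Powers span each factor: first the left power is replaced by an arbitrary element with `Yⁿ`
  -- fixed, then the right one.
  have h1 (Y : g) (n : ℕ) : φ ∘ₗ LinearMap.mulRight k (θ 1 (SymmetricAlgebra.ι k g Y ^ n)) ∘ₗ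
      (θ 0).toLinearMap = 0 :=
    linearMap_ext_ι_pow fun X m => by simpa [hθ] using h X Y m n
  have h2 (s : SymmetricAlgebra k g) : φ ∘ₗ LinearMap.mulLeft k (θ 0 s) ∘ₗ
      (θ 1).toLinearMap = 0 :=
    linearMap_ext_ι_pow fun Y n => LinearMap.congr_fun (h1 Y n) s
  have h3 : φ ∘ₗ (Algebra.TensorProduct.productMap (θ 0) (θ 1)).toLinearMap = 0 :=
    TensorProduct.ext' fun s t => LinearMap.congr_fun (h2 s) t
  refine LinearMap.ext fun f => ?_
  have hf : f ∈ (Algebra.TensorProduct.productMap (θ 0) (θ 1)).range := by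
    induction f using SymmetricAlgebra.induction with
    | algebraMap r => exact Subalgebra.algebraMap_mem _ r
    | ι m =>
      obtain ⟨X, Y, rfl⟩ := exists_eq_tmul_add_tmul m
      exact ⟨SymmetricAlgebra.ι k g X ⊗ₜ 1 + 1 ⊗ₜ SymmetricAlgebra.ι k g Y, by simp [hθ]⟩
    | mul a b ha hb => exact mul_mem ha hb
    | add a b ha hb => exact add_mem ha hb
  obtain ⟨t, rfl⟩ := hf
  exact LinearMap.congr_fun h3 t

end SymSpan

/-! ### Vanishing in the coinvariants and equivariance -/

section Coinvariants

attribute [local instance 100] LieRing.ofAssociativeRing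

open PowerSeries UniversalEnvelopingAlgebra Coalgebra WithConv

variable {k g : Type*} [Field k] [CharZero k] [LieRing g] [LieAlgebra k g]

omit [CharZero k] in
theorem primitiveHom_eq_jMap (X : g) : primitiveHom k g X = jMap k g (X ⊗ₜ 1) := by
  simp [jMap_tmul, primitiveHom_apply]

/-- If `v` and `w` are linearly independent in `k²` then the elements
`([x, y] ⊗ u) (x ⊗ v)ⁱ (y ⊗ w)ʲ` of `U(g) ⊗ U(g)` vanish in the coinvariants. -/
theorem pow_mul_mem_conjSpan (hg : LieModule.lowerCentralSeries k g g 2 = ⊥) (x y : g)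
    (v w u : Fin 2 → k) (hdet : v 0 * w 1 - v 1 * w 0 ≠ 0) (l i j : ℕ) :
    jMap k g (⁅x, y⁆ ⊗ₜ u) ^ (l + 1) * (jMap k g (x ⊗ₜ v) ^ i * jMap k g (y ⊗ₜ w) ^ j) ∈
      conjSpan k (UniversalEnvelopingAlgebra k g) := by
  set ζ := jMap k g (⁅x, y⁆ ⊗ₜ u) with hζ
  set p := jMap k g (x ⊗ₜ v) with hp
  set q := jMap k g (y ⊗ₜ w) with hq
  have hcomm (u' : Fin 2 → k) (b : g ⊗[k] (Fin 2 → k)) :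
      Commute (jMap k g (⁅x, y⁆ ⊗ₜ u')) (jMap k g b) := by
    have := commute_j_br (brMap k g) (jMap k g) (brMap_brMap hg) jMap_mul_sub
      (x ⊗ₜ u') (y ⊗ₜ 1) b
    rwa [brMap_tmul, mul_one] at this
  have hself (a : g) (s t : Fin 2 → k) : Commute (jMap k g (a ⊗ₜ s)) (jMap k g (a ⊗ₜ t)) := by
    have := jMap_mul_sub (a ⊗ₜ[k] s) (a ⊗ₜ t)
    rwa [brMap_tmul, lie_self, TensorProduct.zero_tmul, map_zero, sub_eq_zero] at this
  have hxq : primitiveHom k g x * q = q * primitiveHom k g x + jMap k g (⁅x, y⁆ ⊗ₜ w) := by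
    have := jMap_mul_sub (x ⊗ₜ[k] 1) (y ⊗ₜ w)
    rw [brMap_tmul, one_mul] at this
    rw [primitiveHom_eq_jMap, ← this, hq]; abel
  have hyp : primitiveHom k g y * p = p * primitiveHom k g y + -jMap k g (⁅x, y⁆ ⊗ₜ v) := by
    have := jMap_mul_sub (x ⊗ₜ[k] v) (y ⊗ₜ 1)
    rw [brMap_tmul, mul_one] at this
    rw [primitiveHom_eq_jMap, ← this, hp]; abel
  -- `Δx` commutes with `ζ` and `p`, so its commutator with `ζˡ pⁱ qʲ⁺¹` only differentiates `q`,
  -- yielding `[x, y] ⊗ w`. Symmetrically, `Δy` only differentiates `p` and yields `-[x, y] ⊗ v`.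
  have hw (i j : ℕ) : ζ ^ l * (jMap k g (⁅x, y⁆ ⊗ₜ w) * (dpow k i p * dpow k j q)) ∈
      conjSpan k (UniversalEnvelopingAlgebra k g) := by
    convert commutator_mem_conjSpan x (ζ ^ l * (dpow k i p * dpow k (j + 1) q)) using 1
    have e1 : Commute (primitiveHom k g x) (ζ ^ l) := by
      rw [primitiveHom_eq_jMap]; exact ((hcomm u _).symm).pow_right l
    have e2 : Commute (primitiveHom k g x) (dpow k i p) := by
      rw [primitiveHom_eq_jMap]; exact (hself x 1 v).dpow_right i
    have e3 : Commute (jMap k g (⁅x, y⁆ ⊗ₜ w)) (dpow k i p) := (hcomm w _).dpow_right i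
    rw [e1.left_comm, e2.left_comm, mul_dpow_succ hxq (hcomm w _), e3.left_comm]
    noncomm_ring
  have hv (i j : ℕ) : ζ ^ l * (jMap k g (⁅x, y⁆ ⊗ₜ v) * (dpow k i p * dpow k j q)) ∈
      conjSpan k (UniversalEnvelopingAlgebra k g) := by
    rw [← neg_mem_iff]
    convert commutator_mem_conjSpan y (ζ ^ l * (dpow k (i + 1) p * dpow k j q)) using 1
    have e1 : Commute (primitiveHom k g y) (ζ ^ l) := by
      rw [primitiveHom_eq_jMap]; exact ((hcomm u _).symm).pow_right l
    have e2 : Commute (primitiveHom k g y) (dpow k j q) := by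
      rw [primitiveHom_eq_jMap]; exact (hself y 1 w).dpow_right j
    rw [e1.left_comm, ← mul_assoc (primitiveHom k g y), mul_dpow_succ hyp (hcomm v _).neg_left,
      add_mul, mul_assoc _ (primitiveHom k g y), e2.eq]
    noncomm_ring
  -- Cramer's rule in the basis `w, v`. It is enough to expand one of the `l + 1` factors `ζ`.
  have hu : u = ((u 0 * v 1 - u 1 * v 0) / (v 1 * w 0 - v 0 * w 1)) • w +
      ((w 0 * u 1 - w 1 * u 0) / (v 1 * w 0 - v 0 * w 1)) • v := by
    have hdet' : v 1 * w 0 - v 0 * w 1 ≠ 0 := fun h => hdet (by linear_combination -h)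
    ext i
    fin_cases i
    · simp only [Fin.zero_eta, Pi.add_apply, Pi.smul_apply, smul_eq_mul]
      field_simp
      ring
    · simp only [Fin.mk_one, Pi.add_apply, Pi.smul_apply, smul_eq_mul]
      field_simp
      ring
  have hζ' : ζ = ((u 0 * v 1 - u 1 * v 0) / (v 1 * w 0 - v 0 * w 1)) • jMap k g (⁅x, y⁆ ⊗ₜ w) +
      ((w 0 * u 1 - w 1 * u 0) / (v 1 * w 0 - v 0 * w 1)) • jMap k g (⁅x, y⁆ ⊗ₜ v) := by
    rw [← map_smul, ← map_smul, ← map_add, ← TensorProduct.tmul_smul, ← TensorProduct.tmul_smul,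
      ← TensorProduct.tmul_add, ← hu]
  rw [pow_eq_smul_dpow (k := k) i, pow_eq_smul_dpow (k := k) j, smul_mul_smul_comm, mul_smul_comm]
  refine Submodule.smul_mem _ _ ?_
  rw [pow_succ, mul_assoc]
  nth_rw 2 [hζ']
  rw [add_mul, mul_add, smul_mul_assoc, smul_mul_assoc, mul_smul_comm, mul_smul_comm]
  exact add_mem (Submodule.smul_mem _ _ (hw i j)) (Submodule.smul_mem _ _ (hv i j))

/-- Symmetrization is multiplicative on `pᵐ qⁿ` up to multiples of the commutator of `p, q`. -/
theorem symmetrize_pow_mul_pow_sub_mem {M A : Type*} [AddCommGroup M] [Module k M] [Ring A]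
    [Algebra k A] (br : M →ₗ[k] M →ₗ[k] M) (j : M →ₗ[k] A) (h2 : ∀ a b c, br (br a b) c = 0)
    (h1 : ∀ a, br a a = 0) (hj : ∀ a b, j a * j b - j b * j a = j (br a b)) (p q : M) (m n : ℕ) :
    symmetrize j (SymmetricAlgebra.ι k M p ^ m * SymmetricAlgebra.ι k M q ^ n) - j p ^ m * j q ^ n ∈
      Submodule.span k {a | ∃ l i i', a = j (br p q) ^ (l + 1) * (j p ^ i * j q ^ i')} := by
  set W := Submodule.span k {a | ∃ l i i', a = j (br p q) ^ (l + 1) * (j p ^ i * j q ^ i')}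
  have hcomm (c : M) := commute_j_br br j h2 hj p q c
  have hWp (a : A) (ha : a ∈ W) : j p * a ∈ W := by
    induction ha using Submodule.span_induction with
    | zero => simp
    | add a b _ _ ha hb => rw [mul_add]; exact add_mem ha hb
    | smul r a _ ha => rw [mul_smul_comm]; exact W.smul_mem r ha
    | mem a ha =>
      obtain ⟨l, i, i', rfl⟩ := ha
      refine Submodule.subset_span ⟨l, i + 1, i', ?_⟩
      rw [((hcomm p).symm.pow_right (l + 1)).left_comm, pow_succ' (j p), mul_assoc (j p)]
  have hWc (a : A) (ha : a ∈ W) : j (br p q) * a ∈ W := by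
    induction ha using Submodule.span_induction with
    | zero => simp
    | add a b _ _ ha hb => rw [mul_add]; exact add_mem ha hb
    | smul r a _ ha => rw [mul_smul_comm]; exact W.smul_mem r ha
    | mem a ha =>
      obtain ⟨l, i, i', rfl⟩ := ha
      refine Submodule.subset_span ⟨l + 1, i, i', ?_⟩
      rw [pow_succ' _ (l + 1), mul_assoc (j (br p q))]
  induction m generalizing n with
  | zero => rw [pow_zero, pow_zero, one_mul, one_mul, symmetrize_ι_pow, sub_self]; exact zero_mem W
  | succ m ih =>
    -- The derivation in `p ⋆ (pᵐ qⁿ)` sees only `qⁿ`. The correction is written as a star product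
    -- with the central `[p, q]` so that `symmetrize_starOp` applies to both terms; it involves `n -
    -- 1`, whence the induction for all `n`.
    have e1 : SymmetricAlgebra.ι k M p ^ (m + 1) * SymmetricAlgebra.ι k M q ^ n =
        starOp br p (SymmetricAlgebra.ι k M p ^ m * SymmetricAlgebra.ι k M q ^ n) -
          ((n : k) / 2) • starOp br (br p q)
            (SymmetricAlgebra.ι k M p ^ m * SymmetricAlgebra.ι k M q ^ (n - 1)) := by
      rw [starOp_br br h2, starOp_apply, Derivation.leibniz, symDer_ι_pow, symDer_ι_pow, h1,
        map_zero, zero_mul, smul_zero, smul_zero, add_zero, smul_eq_mul, mul_smul_comm,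
        pow_succ', mul_assoc, mul_left_comm _ (SymmetricAlgebra.ι k M (br p q))]
      module
    have e2 : j p ^ (m + 1) * j q ^ n = j p * (j p ^ m * j q ^ n) := by
      rw [pow_succ', mul_assoc]
    rw [e1, map_sub, map_smul, symmetrize_starOp br j h2 hj, symmetrize_starOp br j h2 hj, e2,
      sub_right_comm, ← mul_sub]
    refine sub_mem (hWp _ (ih n)) (W.smul_mem _ ?_)
    have h3 := hWc _ (ih (n - 1))
    rw [mul_sub] at h3
    refine (W.sub_mem_iff_left ?_).1 h3
    exact Submodule.subset_span ⟨0, m, n - 1, by simp⟩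

/-- The pair of words sends `exp(sx) ⊗ exp(ty)` to `exp(st ζ) exp(s p) exp(t q)`, and the
independence of the exponent columns removes everything containing `ζ`. -/
theorem evalWords_dpow_sub_mem (hg : LieModule.lowerCentralSeries k g g 2 = ⊥) (x y : g)
    (u v : FreeGroup (Fin 2))
    (hdet : ((expVec u).toAdd 0 : k) * ((expVec v).toAdd 1 : k) -
      ((expVec v).toAdd 0 : k) * ((expVec u).toAdd 1 : k) ≠ 0) (m n : ℕ) :
    evalWords k (UniversalEnvelopingAlgebra k g) u v (dpow k m (ι k x) ⊗ₜ dpow k n (ι k y)) -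
      dpow k m (jMap k g (x ⊗ₜ ![((expVec u).toAdd 0 : k), ((expVec v).toAdd 0 : k)])) *
      dpow k n (jMap k g (y ⊗ₜ ![((expVec u).toAdd 1 : k), ((expVec v).toAdd 1 : k)])) ∈
      conjSpan k (UniversalEnvelopingAlgebra k g) := by
  obtain ⟨c, hc⟩ := exists_genFun_word hg x y
    (Algebra.TensorProduct.includeLeft : UniversalEnvelopingAlgebra k g →ₐ[k]
      UniversalEnvelopingAlgebra k g ⊗[k] UniversalEnvelopingAlgebra k g) u
  obtain ⟨c', hc'⟩ := exists_genFun_word hg x y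
    (Algebra.TensorProduct.includeRight : UniversalEnvelopingAlgebra k g →ₐ[k]
      UniversalEnvelopingAlgebra k g ⊗[k] UniversalEnvelopingAlgebra k g) v
  set a := ((expVec u).toAdd 0 : k)
  set b := ((expVec u).toAdd 1 : k)
  set a' := ((expVec v).toAdd 0 : k)
  set b' := ((expVec v).toAdd 1 : k)
  have hj (X : g) (r s : k) : jMap k g (X ⊗ₜ ![r, s]) =
      r • (ι k X ⊗ₜ 1) + s • (1 ⊗ₜ ι k X) := by simp [jMap_tmul]
  have hLR (r s : k) (X Y : g) : Commute (r • (ι k X ⊗ₜ[k] (1 : UniversalEnvelopingAlgebra k g)))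
      (s • ((1 : UniversalEnvelopingAlgebra k g) ⊗ₜ[k] ι k Y)) := by
    refine Commute.smul_left (Commute.smul_right ?_ s) r
    simp [Commute, SemiconjBy]
  -- The Heisenberg elements of `u` and `v` lie in commuting tensor factors, so their `z`-, `x`- and
  -- `y`-exponentials can be regrouped and merged pairwise.
  have key : genFun x y (toConv (evalWords k (UniversalEnvelopingAlgebra k g) u v).toLinearMap) =
      expS k (monomial 1 (jMap k g (⁅x, y⁆ ⊗ₜ ![c, c']))) *
        (C (expS k (jMap k g (x ⊗ₜ ![a, a']))) * expS k (C (jMap k g (y ⊗ₜ ![b, b'])))) := by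
    rw [evalWords, pair_eq_convMul, map_mul, hc, hc', hj, hj, hj, expS_add (hLR _ _ _ _), map_add,
      map_add, expS_add ((hLR _ _ _ _).map C), expS_add, map_mul]
    · simp only [heis, Algebra.TensorProduct.includeLeft_apply,
        Algebra.TensorProduct.includeRight_apply, mul_assoc]
      rw [(commute_heis_two (k := k) (hLR b c' y ⁅x, y⁆).symm).symm.left_comm,
        (commute_heis_one (k := k) (hLR a c' x ⁅x, y⁆).symm).symm.left_comm]
      have hxy : Commute (expS k (C (b • (ι k y ⊗ₜ[k] (1 : UniversalEnvelopingAlgebra k g)))))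
          (C (expS k (a' • ((1 : UniversalEnvelopingAlgebra k g) ⊗ₜ[k] ι k x)))) := by
        refine (C_mul_expS ?_).symm
        exact (C_mul_expS (hLR b a' y x)).symm
      rw [hxy.left_comm]
    · simp only [Commute, SemiconjBy, monomial_mul_monomial, (hLR c c' ⁅x, y⁆ ⁅x, y⁆).eq]
  have h := coeff_heis_sub_mem (conjSpan k (UniversalEnvelopingAlgebra k g)) _ _ _
    (pow_mul_mem_conjSpan hg x y ![a, a'] ![b, b'] ![c, c'] (by simpa using hdet)) m n
  rw [← key, coeff_genFun] at h
  exact h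

theorem sigma_ι_pow_mul_ι_pow (X Y : g) (m n : ℕ) :
    sigma k g (SymmetricAlgebra.ι k _ (X ⊗ₜ Pi.single 0 1) ^ m *
      SymmetricAlgebra.ι k _ (Y ⊗ₜ Pi.single 1 1) ^ n) = (ι k X ^ m) ⊗ₜ (ι k Y ^ n) := by
  have h0 : symSplit k g (SymmetricAlgebra.ι k _ (X ⊗ₜ Pi.single 0 1)) =
      SymmetricAlgebra.ι k g X ⊗ₜ 1 := by simp [symSplit]
  have h1 : symSplit k g (SymmetricAlgebra.ι k _ (Y ⊗ₜ Pi.single 1 1)) =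
      1 ⊗ₜ SymmetricAlgebra.ι k g Y := by simp [symSplit]
  rw [sigma, LinearMap.comp_apply, AlgHom.toLinearMap_apply, map_mul, map_pow, map_pow, h0, h1]
  simp [Algebra.TensorProduct.tmul_pow, sigmaOne, symmetrize_ι_pow]

/-- On `(X ⊗ e₀)ᵐ (Y ⊗ e₁)ⁿ` both sides are congruent to the ordered product `pᵐ qⁿ` in `U(g) ⊗
U(g)`, where `p` and `q` use the two columns of the matrix of `ψ`. -/
theorem sigma_rhoS_sub_mem (hg : LieModule.lowerCentralSeries k g g 2 = ⊥)
    (ψ : MulAut (FreeGroup (Fin 2))) (f : SymG k g) :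
    sigma k g (rhoS k g (autToGL ψ) f) -
      rhoAut k (UniversalEnvelopingAlgebra k g) ψ (sigma k g f) ∈
        conjSpan k (UniversalEnvelopingAlgebra k g) := by
  have hdet : ((expVec (ψ⁻¹ (.of 0))).toAdd 0 : k) * ((expVec (ψ⁻¹ (.of 1))).toAdd 1 : k) -
      ((expVec (ψ⁻¹ (.of 1))).toAdd 0 : k) * ((expVec (ψ⁻¹ (.of 0))).toAdd 1 : k) ≠ 0 := by
    have h1 : IsUnit (autToGL ψ).val.det := (autToGL ψ).isUnit.map Matrix.detMonoidHom
    -- The integral determinant is a unit, so it stays nonzero in `k`.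
    have h2 := (h1.map (Int.castRingHom k)).ne_zero
    rw [Matrix.det_fin_two] at h2
    have h3 (i j : Fin 2) : (autToGL ψ).val i j = (expVec (ψ⁻¹ (.of i))).toAdd j := rfl
    rw [h3, h3, h3, h3] at h2
    simpa [mul_comm] using h2
  rw [← Submodule.Quotient.mk_eq_zero (conjSpan k (UniversalEnvelopingAlgebra k g)), ← Submodule.mkQ_apply]
  suffices h : (conjSpan k (UniversalEnvelopingAlgebra k g)).mkQ ∘ₗ
      (sigma k g ∘ₗ rhoS k g (autToGL ψ) -
        rhoAut k (UniversalEnvelopingAlgebra k g) ψ ∘ₗ sigma k g) = 0 from LinearMap.congr_fun h f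
  refine linearMap_eq_zero_of_ι_pow_mul_ι_pow _ fun X Y m n => ?_
  rw [LinearMap.comp_apply, Submodule.mkQ_apply, Submodule.Quotient.mk_eq_zero,
    LinearMap.sub_apply, LinearMap.comp_apply, LinearMap.comp_apply, sigma_ι_pow_mul_ι_pow]
  have hv := evalWords_dpow_sub_mem hg X Y _ _ hdet m n
  have hι (Z : g) (i : Fin 2) : rhoS k g (autToGL ψ)
      (SymmetricAlgebra.ι k _ (Z ⊗ₜ Pi.single i 1)) = SymmetricAlgebra.ι k _ (Z ⊗ₜ
        ![((expVec (ψ⁻¹ (.of 0))).toAdd i : k), ((expVec (ψ⁻¹ (.of 1))).toAdd i : k)]) := by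
    refine (symMap_ι (LinearMap.lTensor g (Matrix.toLin' ((autToGL ψ).val.map
      (Int.cast : ℤ → k)))) _).trans ?_
    rw [LinearMap.lTensor_tmul, Matrix.toLin'_apply]
    congr 2
    ext j
    rw [Matrix.mulVec_single_one]
    fin_cases j <;> rfl
  have hmul : rhoS k g (autToGL ψ) (SymmetricAlgebra.ι k _ (X ⊗ₜ Pi.single 0 1) ^ m *
      SymmetricAlgebra.ι k _ (Y ⊗ₜ Pi.single 1 1) ^ n) =
      rhoS k g (autToGL ψ) (SymmetricAlgebra.ι k _ (X ⊗ₜ Pi.single 0 1)) ^ m *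
      rhoS k g (autToGL ψ) (SymmetricAlgebra.ι k _ (Y ⊗ₜ Pi.single 1 1)) ^ n := by
    let F := symMap (LinearMap.lTensor g (Matrix.toLin' ((autToGL ψ).val.map (Int.cast : ℤ → k))))
    have hF (f : SymG k g) : rhoS k g (autToGL ψ) f = F f := rfl
    rw [hF, hF, hF, map_mul, map_pow, map_pow]
  rw [hmul, hι, hι]
  set p : g ⊗[k] (Fin 2 → k) := X ⊗ₜ
    ![((expVec (ψ⁻¹ (.of 0))).toAdd 0 : k), ((expVec (ψ⁻¹ (.of 1))).toAdd 0 : k)] with hp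
  set q : g ⊗[k] (Fin 2 → k) := Y ⊗ₜ
    ![((expVec (ψ⁻¹ (.of 0))).toAdd 1 : k), ((expVec (ψ⁻¹ (.of 1))).toAdd 1 : k)] with hq
  have hs : sigma k g (SymmetricAlgebra.ι k _ p ^ m * SymmetricAlgebra.ι k _ q ^ n) -
      jMap k g p ^ m * jMap k g q ^ n ∈ conjSpan k (UniversalEnvelopingAlgebra k g) := by
    rw [sigma_eq_symmetrize]
    refine (Submodule.span_le (R := k)).2 ?_ (symmetrize_pow_mul_pow_sub_mem (brMap k g)
      (jMap k g) (brMap_brMap hg) brMap_self jMap_mul_sub p q m n)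
    rintro _ ⟨l, i, i', rfl⟩
    exact pow_mul_mem_conjSpan hg X Y _ _ _ (by simpa using hdet) l i i'
  have hr : rhoAut k (UniversalEnvelopingAlgebra k g) ψ ((ι k X ^ m) ⊗ₜ (ι k Y ^ n)) -
      jMap k g p ^ m * jMap k g q ^ n ∈ conjSpan k (UniversalEnvelopingAlgebra k g) := by
    rw [pow_eq_smul_dpow (k := k) m, pow_eq_smul_dpow (k := k) n, pow_eq_smul_dpow (k := k) m,
      pow_eq_smul_dpow (k := k) n, smul_mul_smul_comm, TensorProduct.smul_tmul_smul, map_smul,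
      ← smul_sub]
    exact Submodule.smul_mem _ _ hv
  have := sub_mem hs hr
  rwa [sub_sub_sub_cancel_right] at this

end Coinvariants

end HopfOut

end

theorem mainTheorem6 {k g : Type*} [Field k] [CharZero k] [LieRing g] [LieAlgebra k g]
    (hg : LieModule.lowerCentralSeries k g g 2 = ⊥) :
    Function.Surjective HopfOut.outToGL ∧
    ∃ e : HopfOut.SymBar k g ≃ₗ[k] HopfOut.HBar k (UniversalEnvelopingAlgebra k g),
      (∀ f : HopfOut.SymG k g,
        e (Submodule.Quotient.mk f) = Submodule.Quotient.mk (HopfOut.sigma k g f)) ∧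
      ∀ (ψ : HopfOut.Out (FreeGroup (Fin 2))) (v : HopfOut.SymBar k g),
        e (HopfOut.rhoSBar k g (HopfOut.outToGL ψ) v) =
          HopfOut.rhoOut k (UniversalEnvelopingAlgebra k g) ψ (e v) := by
  refine ⟨HopfOut.outToGL_surjective, HopfOut.sigmaBar hg, HopfOut.sigmaBar_mk hg, fun ψ v => ?_⟩
  obtain ⟨ψ, rfl⟩ := QuotientGroup.mk_surjective ψ
  obtain ⟨f, rfl⟩ := Submodule.Quotient.mk_surjective _ v
  exact (Submodule.Quotient.eq _).2 (HopfOut.sigma_rhoS_sub_mem hg ψ f)
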